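/- **Setting.** Let $F,f:\mathbb R^d\times\mathbb R^s\to\mathbb R$, $G:\mathbb R^d\times\mathbb R^s\to\mathbb R^p$, $H:\mathbb R^d\times\mathbb R^s\to\mathbb R^q$, $g:\mathbb R^d\times\mathbb R^s\to\mathbb R^m$, $h:\mathbb R^d\times\mathbb R^s\to\mathbb R^n$, where $F$ is locally Lipschitz, $G,H,f,g,h$ are continuously differentiable, and the partial gradients $\nabla_yf,\nabla_yg_i,\nabla_yh_i$ are continuously differentiable functions of $(x,y)$. Put $Y(x)=\{y: g(x,y)\le 0,\ h(x,y)=0\}$ and $V(x)=\inf_{y\in Y(x)}f(x,y)\in[-\infty,\infty]$. The combined program is $$(\mathrm{CP})\quad \min_{x,y,u,v}F(x,y)\ \text{ s.t. }\ f(x,y)-V(x)\le 0,\ G(x,y)\le 0,\ H(x,y)=0,\ h(x,y)=0,$$ $$\nabla_yf(x,y)+\nabla_yg(x,y)^Tu+\nabla_yh(x,y)^Tv=0,\quad 0\le -g(x,y)\perp u\ge 0 .$$ **Subdifferentials.** For $\varphi:\mathbb R^N\to\mathbb R$, $\widehat\partial\varphi(z)$ is the set of $\zeta$ with $\varphi(z')-\varphi(z)-\langle\zeta,z'-z\rangle\ge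 o(\|z'-z\|)$ as $z'\to z$, and $\partial\varphi(z)$ is the set of limits of sequences $\xi^k\in\widehat\partial\varphi(z^k)$ with $z^k\to z$ and $\varphi(z^k)\to\varphi(z)$. **RCPLD and M-stationarity.** Consider a system $g_i(z)\le0$ $(i\in A)$, $h_i(z)=0$ $(i\in B)$, $0\le G_i(z)\perp H_i(z)\ge0$ $(i\in D)$ on $\mathbb R^N$ with finite index sets. At a feasible $z^*$ let $I_g^*=\{i:g_i(z^*)=0\}$, $\mathcal I^*=\{i:0=G_i(z^*)<H_i(z^*)\}$, $\mathcal J^*=\{i:G_i(z^*)=H_i(z^*)=0\}$, $\mathcal K^*=\{i:G_i(z^*)>H_i(z^*)=0\}$. *RCPLD* holds at $z^*$ if (i) the rank of $\{\nabla h_i(z)\}_{i\in B}\cup\{\nabla G_i(z)\}_{i\in\mathcal I^*}\cup\{\nabla H_i(z)\}_{i\in\mathcal K^*}$ is constant for $z$ near $z^*$; (ii) whenever $\mathcal I_1\subseteq B$, $\mathcal I_2\subseteq\mathcal I^*$, $\mathcal I_3\subseteq\mathcal K^*$ are such that $\{\nabla h_i(z^*)\}_{\mathcal I_1}\cup\{\nabla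 G_i(z^*)\}_{\mathcal I_2}\cup\{\nabla H_i(z^*)\}_{\mathcal I_3}$ is a basis of the span of the vectors in (i) at $z^*$, and $\mathcal I_4\subseteq I_g^*$, $\mathcal I_5,\mathcal I_6\subseteq\mathcal J^*$, and there are $v_i^*\in\partial g_i(z^*)$ $(i\in\mathcal I_4)$ and multipliers $\lambda^g_{\mathcal I_4}\ge0$, $\lambda^h_{\mathcal I_1}$, $\lambda^G_{\mathcal I_2\cup\mathcal I_5}$, $\lambda^H_{\mathcal I_3\cup\mathcal I_6}$, not all zero (and extended by zero to the other indices), with either $\lambda_i^G>0,\lambda_i^H>0$ or $\lambda_i^G\lambda_i^H=0$ for all $i\in\mathcal J^*$, and $$0=\sum_{\mathcal I_4}\lambda^g_iv_i^*+\sum_{\mathcal I_1}\lambda^h_i\nabla h_i(z^*)-\sum_{\mathcal I_2\cup\mathcal I_5}\lambda_i^G\nabla G_i(z^*)-\sum_{\mathcal I_3\cup\mathcal I_6}\lambda^H_i\nabla H_i(z^*),$$ then for all sequences $z^k\to z^*$, $z^k\ne z^*$, and $v_i^k\in\partial g_i(z^k)$, $v_i^k\to v_i^*$ $(i\in\mathcal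 I_4)$, the family $\{v_i^k\}_{\mathcal I_4}\cup\{\nabla h_i(z^k)\}_{\mathcal I_1}\cup\{\nabla G_i(z^k)\}_{\mathcal I_2\cup\mathcal I_5}\cup\{\nabla H_i(z^k)\}_{\mathcal I_3\cup\mathcal I_6}$ is linearly dependent for all sufficiently large $k$. The point $z^*$ is *M-stationary* for minimizing $\varphi$ subject to the system if there are $\lambda_i^g\ge0$ $(i\in I_g^*)$, $\lambda^h$, $\lambda^G$, $\lambda^H$ with $$0\in\partial\varphi(z^*)+\sum_{i\in I_g^*}\lambda_i^g\partial g_i(z^*)+\sum_{i\in B}\lambda_i^h\nabla h_i(z^*)-\sum_{\mathcal I^*\cup\mathcal J^*}\lambda_i^G\nabla G_i(z^*)-\sum_{\mathcal K^*\cup\mathcal J^*}\lambda_i^H\nabla H_i(z^*),$$ $\lambda^H_i=0$ on $\mathcal I^*$, $\lambda_i^G=0$ on $\mathcal K^*$, and either $\lambda_i^G>0,\lambda_i^H>0$ or $\lambda_i^G\lambda_i^H=0$ on $\mathcal J^*$. For (CP) these notions are applied in the variable $z=(x,y,u,v)$ with $\varphi=F$, the inequalities $f-V\le 0$ and $G\le0$,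 the equalities $H=0$, $h=0$, $\nabla_yf+\nabla_yg^Tu+\nabla_yh^Tv=0$, and the complementarity constraints $0\le-g\perp u\ge0$. **Theorem 5.1.** Let $(x^*,y^*,u^*,v^*)$ be a local solution of (CP), and suppose that $V$ is Lipschitz continuous at $x^*$ (finite and Lipschitz on a neighbourhood of $x^*$). If RCPLD holds at $(x^*,y^*,u^*,v^*)$ for the constraints of (CP), then $(x^*,y^*,u^*,v^*)$ is an M-stationary point of (CP). -/

import Mathlib

open Filter Topology
open scoped RealInnerProductSpace

namespace BilevelRCPLD

noncomputable section

/-! ### Subdifferentials -/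

section Subdifferential

variable {E : Type*} [NormedAddCommGroup E] [InnerProductSpace ℝ E]

/-- The regular (Fréchet) subdifferential of `φ` at `x`: all `ζ` with
`φ x' - φ x - ⟪ζ, x' - x⟫ ≥ o(‖x' - x‖)` as `x' → x`. -/
def regularSubdiff (φ : E → ℝ) (x : E) : Set E :=
  {ζ | ∀ ε : ℝ, 0 < ε →
    ∀ᶠ x' in 𝓝 x, -(ε * ‖x' - x‖) ≤ φ x' - φ x - ⟪ζ, x' - x⟫}

/-- The limiting (Mordukhovich) subdifferential of `φ` at `x`: all limits of regular
subgradients `ξ k` of `φ` at points `xk k` with `xk k → x` and `φ (xk k) → φ x`. -/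
def limitingSubdiff (φ : E → ℝ) (x : E) : Set E :=
  {ζ | ∃ (xk ξ : ℕ → E), (∀ k, ξ k ∈ regularSubdiff φ (xk k)) ∧
    Tendsto xk atTop (𝓝 x) ∧ Tendsto (fun k => φ (xk k)) atTop (𝓝 (φ x)) ∧
    Tendsto ξ atTop (𝓝 ζ)}

end Subdifferential

/-! ### Systems with inequalities, equalities and complementarity constraints -/

/-- The functions of the system
`g i z ≤ 0`, `h j z = 0`, `0 ≤ G l z ⊥ H l z ≥ 0` on the space `E`
(there is no abstract constraint: the abstract set is the whole space). -/
structure FeasSystem (E ι κ π : Type*) where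
  g : ι → E → ℝ
  h : κ → E → ℝ
  G : π → E → ℝ
  H : π → E → ℝ

namespace FeasSystem

variable {E ι κ π : Type*}

/-- Indices of the active inequalities. -/
def activeSet (S : FeasSystem E ι κ π) (x : E) : Set ι := {i | S.g i x = 0}

/-- Indices with `0 = G i x < H i x`. -/
def setI (S : FeasSystem E ι κ π) (x : E) : Set π := {i | S.G i x = 0 ∧ 0 < S.H i x}

/-- Indices with `0 = G i x = H i x`. -/
def setJ (S : FeasSystem E ι κ π) (x : E) : Set π := {i | S.G i x = 0 ∧ S.H i x = 0}

/-- Indices with `G i x > H i x = 0`. -/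
def setK (S : FeasSystem E ι κ π) (x : E) : Set π := {i | 0 < S.G i x ∧ S.H i x = 0}

variable [NormedAddCommGroup E] [InnerProductSpace ℝ E] [CompleteSpace E]

/-- The family consisting of `∇ h i x` (`i : κ`), `∇ G i x` (`i : π`), `∇ H i x` (`i : π`). -/
def smoothGrads (S : FeasSystem E ι κ π) (x : E) : κ ⊕ π ⊕ π → E :=
  Sum.elim (fun i => gradient (S.h i) x)
    (Sum.elim (fun i => gradient (S.G i) x) (fun i => gradient (S.H i) x))

/-- The indices of the members `∇ h i` (`i ∈ A`), `∇ G i` (`i ∈ B`), `∇ H i` (`i ∈ C`) of the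
family of gradients. -/
def gradIndices (A : Set κ) (B C : Set π) : Set (κ ⊕ π ⊕ π) :=
  Sum.inl '' A ∪ (Sum.inr ∘ Sum.inl) '' B ∪ (Sum.inr ∘ Sum.inr) '' C

/-- The relaxed constant positive linear dependence constraint qualification at `x`.
Linear (in)dependence is that of indexed families. The multipliers in the second
condition are extended by zero outside the index sets over which the linear combination runs. -/
def RCPLD [Fintype ι] [Fintype κ] [Fintype π] (S : FeasSystem E ι κ π) (x : E) : Prop :=
  (∀ᶠ x' in 𝓝 x,
    Module.finrank ℝ (Submodule.span ℝ
      (S.smoothGrads x' '' gradIndices Set.univ (S.setI x) (S.setK x))) =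
    Module.finrank ℝ (Submodule.span ℝ
      (S.smoothGrads x '' gradIndices Set.univ (S.setI x) (S.setK x)))) ∧
  ∀ (I₁ : Set κ) (I₂ I₃ : Set π), I₂ ⊆ S.setI x → I₃ ⊆ S.setK x →
    -- the gradients indexed by `I₁`, `I₂`, `I₃` form a basis of the full span at `x`
    LinearIndepOn ℝ (S.smoothGrads x) (gradIndices I₁ I₂ I₃) →
    Submodule.span ℝ (S.smoothGrads x '' gradIndices I₁ I₂ I₃) =
      Submodule.span ℝ (S.smoothGrads x '' gradIndices Set.univ (S.setI x) (S.setK x)) →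
    ∀ (I₄ : Set ι) (I₅ I₆ : Set π), I₄ ⊆ S.activeSet x → I₅ ⊆ S.setJ x → I₆ ⊆ S.setJ x →
    ∀ (lg : ι → ℝ) (lh : κ → ℝ) (lG lH : π → ℝ) (v : ι → E),
      (∀ i, i ∉ I₄ → lg i = 0) → (∀ i, i ∉ I₁ → lh i = 0) →
      (∀ i, i ∉ I₂ ∪ I₅ → lG i = 0) → (∀ i, i ∉ I₃ ∪ I₆ → lH i = 0) →
      ¬ (lg = 0 ∧ lh = 0 ∧ lG = 0 ∧ lH = 0) →
      (∀ i ∈ I₄, 0 ≤ lg i) →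
      (∀ i ∈ S.setJ x, (0 < lG i ∧ 0 < lH i) ∨ lG i * lH i = 0) →
      (∀ i ∈ I₄, v i ∈ limitingSubdiff (S.g i) x) →
      0 = ∑ i, lg i • v i + ∑ i, lh i • gradient (S.h i) x
          - ∑ i, lG i • gradient (S.G i) x - ∑ i, lH i • gradient (S.H i) x →
      ∀ (xk : ℕ → E) (vk : ℕ → ι → E),
        (∀ k, xk k ≠ x) →
        (∀ k, ∀ i ∈ I₄, vk k i ∈ limitingSubdiff (S.g i) (xk k)) →
        Tendsto xk atTop (𝓝 x) →
        (∀ i ∈ I₄, Tendsto (fun k => vk k i) atTop (𝓝 (v i))) →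
        ∀ᶠ k in atTop,
          ¬ LinearIndepOn ℝ (Sum.elim (vk k) (S.smoothGrads (xk k)))
            (Sum.inl '' I₄ ∪ Sum.inr '' gradIndices I₁ (I₂ ∪ I₅) (I₃ ∪ I₆))

/-- `x` is M-stationary for minimizing `φ` subject to the system `S`. The multiplier of an
inactive inequality is zero, and at a feasible point the last conditions confine
`lG` to the indices in `setI ∪ setJ` and `lH` to those in `setK ∪ setJ`. -/
def MStationary [Fintype ι] [Fintype κ] [Fintype π] (S : FeasSystem E ι κ π)
    (φ : E → ℝ) (x : E) : Prop :=
  ∃ (ξ : E) (v : ι → E) (lg : ι → ℝ) (lh : κ → ℝ) (lG lH : π → ℝ),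
    ξ ∈ limitingSubdiff φ x ∧
    (∀ i ∈ S.activeSet x, v i ∈ limitingSubdiff (S.g i) x) ∧
    (∀ i ∈ S.activeSet x, 0 ≤ lg i) ∧ (∀ i, i ∉ S.activeSet x → lg i = 0) ∧
    0 = ξ + ∑ i, lg i • v i + ∑ i, lh i • gradient (S.h i) x
        - ∑ i, lG i • gradient (S.G i) x - ∑ i, lH i • gradient (S.H i) x ∧
    (∀ i ∈ S.setI x, lH i = 0) ∧ (∀ i ∈ S.setK x, lG i = 0) ∧
    (∀ i ∈ S.setJ x, (0 < lG i ∧ 0 < lH i) ∨ lG i * lH i = 0)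

end FeasSystem

/-! ### The bilevel program and the combined program -/

/-- The space of the variables `(x, y, u, v)` of the combined program, with its Euclidean norm. -/
abbrev CPSpace (d s m n : ℕ) := EuclideanSpace ℝ (Fin d ⊕ Fin s ⊕ Fin m ⊕ Fin n)

section Coordinates

variable {d s m n : ℕ}

/-- The `x`-part of `(x, y, u, v)`. -/
def xPart (z : CPSpace d s m n) : EuclideanSpace ℝ (Fin d) :=
  WithLp.toLp 2 fun i => z (Sum.inl i)

/-- The `y`-part of `(x, y, u, v)`. -/
def yPart (z : CPSpace d s m n) : EuclideanSpace ℝ (Fin s) :=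
  WithLp.toLp 2 fun i => z (Sum.inr (Sum.inl i))

/-- The `u`-part of `(x, y, u, v)`. -/
def uPart (z : CPSpace d s m n) : EuclideanSpace ℝ (Fin m) :=
  WithLp.toLp 2 fun i => z (Sum.inr (Sum.inr (Sum.inl i)))

/-- The `v`-part of `(x, y, u, v)`. -/
def vPart (z : CPSpace d s m n) : EuclideanSpace ℝ (Fin n) :=
  WithLp.toLp 2 fun i => z (Sum.inr (Sum.inr (Sum.inr i)))

end Coordinates

/-- The functions of a bilevel program: upper level objective `F` and constraints
`G i (x, y) ≤ 0`, `H i (x, y) = 0`; lower level objective `f` and constraints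
`g i (x, y) ≤ 0`, `h i (x, y) = 0`. -/
structure BilevelProgram (d s p q m n : ℕ) where
  F : EuclideanSpace ℝ (Fin d) → EuclideanSpace ℝ (Fin s) → ℝ
  G : Fin p → EuclideanSpace ℝ (Fin d) → EuclideanSpace ℝ (Fin s) → ℝ
  H : Fin q → EuclideanSpace ℝ (Fin d) → EuclideanSpace ℝ (Fin s) → ℝ
  f : EuclideanSpace ℝ (Fin d) → EuclideanSpace ℝ (Fin s) → ℝ
  g : Fin m → EuclideanSpace ℝ (Fin d) → EuclideanSpace ℝ (Fin s) → ℝ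
  h : Fin n → EuclideanSpace ℝ (Fin d) → EuclideanSpace ℝ (Fin s) → ℝ

/-- The partial gradient `∇_y φ (x, y)`. -/
def gradY {d s : ℕ} (φ : EuclideanSpace ℝ (Fin d) → EuclideanSpace ℝ (Fin s) → ℝ)
    (x : EuclideanSpace ℝ (Fin d)) (y : EuclideanSpace ℝ (Fin s)) : EuclideanSpace ℝ (Fin s) :=
  gradient (φ x) y

namespace BilevelProgram

variable {d s p q m n : ℕ}

/-- The lower level feasible set `Y(x)`. -/
def lowerFeasible (P : BilevelProgram d s p q m n) (x : EuclideanSpace ℝ (Fin d)) :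
    Set (EuclideanSpace ℝ (Fin s)) :=
  {y | (∀ i, P.g i x y ≤ 0) ∧ ∀ i, P.h i x y = 0}

/-- The value function `V(x) = inf {f(x, y) : y ∈ Y(x)}`, with values in `[-∞, ∞]`. -/
def V (P : BilevelProgram d s p q m n) (x : EuclideanSpace ℝ (Fin d)) : EReal :=
  ⨅ y ∈ P.lowerFeasible x, (P.f x y : EReal)

/-- `V` is Lipschitz continuous at `x`: finite and Lipschitz on a neighbourhood of `x`. -/
def VLipschitzAt (P : BilevelProgram d s p q m n) (x : EuclideanSpace ℝ (Fin d)) : Prop :=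
  ∃ U ∈ 𝓝 x, (∀ x' ∈ U, P.V x' ≠ ⊤ ∧ P.V x' ≠ ⊥) ∧
    ∃ L : NNReal, LipschitzOnWith L (fun x' => (P.V x').toReal) U

/-- `∇_y f(x,y) + ∇_y g(x,y)ᵀ u + ∇_y h(x,y)ᵀ v`. -/
def lagrangianGradY (P : BilevelProgram d s p q m n) (z : CPSpace d s m n) :
    EuclideanSpace ℝ (Fin s) :=
  gradY P.f (xPart z) (yPart z)
    + ∑ i, uPart z i • gradY (P.g i) (xPart z) (yPart z)
    + ∑ i, vPart z i • gradY (P.h i) (xPart z) (yPart z)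

/-- The feasible set of the combined program:
`f(x,y) - V(x) ≤ 0`, `G(x,y) ≤ 0`, `H(x,y) = 0`, `h(x,y) = 0`,
`∇_y f(x,y) + ∇_y g(x,y)ᵀ u + ∇_y h(x,y)ᵀ v = 0`, `0 ≤ -g(x,y) ⊥ u ≥ 0`. -/
def cpFeasible (P : BilevelProgram d s p q m n) : Set (CPSpace d s m n) :=
  {z | (P.f (xPart z) (yPart z) : EReal) ≤ P.V (xPart z) ∧
    (∀ i, P.G i (xPart z) (yPart z) ≤ 0) ∧
    (∀ i, P.H i (xPart z) (yPart z) = 0) ∧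
    (∀ i, P.h i (xPart z) (yPart z) = 0) ∧
    P.lagrangianGradY z = 0 ∧
    ∀ i, 0 ≤ -P.g i (xPart z) (yPart z) ∧ 0 ≤ uPart z i ∧
      -P.g i (xPart z) (yPart z) * uPart z i = 0}

/-- The objective `(x, y, u, v) ↦ F(x, y)` of the combined program. -/
def cpObjective (P : BilevelProgram d s p q m n) (z : CPSpace d s m n) : ℝ :=
  P.F (xPart z) (yPart z)

/-- `z` is a local solution of the combined program. -/
def IsLocalSolutionCP (P : BilevelProgram d s p q m n) (z : CPSpace d s m n) : Prop :=
  z ∈ P.cpFeasible ∧ IsLocalMinOn P.cpObjective P.cpFeasible z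

/-- The constraints of the combined program as a system of inequalities
(`f - V`, then the components of `G`), equalities (the components of `H`, of `h` and of
`∇_y f + ∇_y gᵀ u + ∇_y hᵀ v`) and complementarity constraints `0 ≤ -g ⊥ u ≥ 0`.
Where `V` is finite, its solutions are the feasible points of the combined program. -/
def cpSystem (P : BilevelProgram d s p q m n) :
    FeasSystem (CPSpace d s m n) (Unit ⊕ Fin p) (Fin q ⊕ Fin n ⊕ Fin s) (Fin m) where
  g := Sum.elim (fun _ z => P.f (xPart z) (yPart z) - (P.V (xPart z)).toReal)
    (fun i z => P.G i (xPart z) (yPart z))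
  h := Sum.elim (fun i z => P.H i (xPart z) (yPart z))
    (Sum.elim (fun i z => P.h i (xPart z) (yPart z)) (fun i z => P.lagrangianGradY z i))
  G := fun i z => -P.g i (xPart z) (yPart z)
  H := fun i z => uPart z i

end BilevelProgram

end

end BilevelRCPLD

/-! Only two features of (CP) matter. Near the solution `V` is finite and Lipschitz, so (CP)
coincides locally with `cpSystem`. The inequality data and the objective are then locally Lipschitz,
while the equality and complementarity data are C¹. The theorem is therefore a case of
`FeasSystem.RCPLD.mStationary`, which holds for any such system on a finite-dimensional space.

Multipliers come from quadratic penalization. Let `k ρ` penalize half the squared distance from the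
constraint values to the admissible values. Minimizers `z k` of φ + ½‖· - x‖² + k ρ converge to `x`.
Squared distance to a nonconvex set is awkward to differentiate, but distance to one fixed nearest
point bounds it from above with equality at `z k`. Expanding that bound leaves a weighted sum of the
constraints plus a quadratic (`isLocalMin_linearized`). The limiting sum rule then gives approximate
stationarity at `z k`, with multipliers `k` times the residual; the geometry of the complementarity
set gives them the M-signs (`compResidual_sign`).

These multipliers may be unbounded. Constant rank lets a basis `B` of the fixed-status gradients at
`x` remain a basis of their span nearby, and a Carathéodory reduction makes the multipliers
supported on an independent family without changing the signs that count. With the support constant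
along a subsequence and the multipliers normalized, the limit either gives M-stationarity or is a
nontrivial singular relation. RCPLD would make the latter's family dependent at nearby points,
contradicting independence (`RCPLD.eq_zero_of_linearIndepOn`). -/

namespace BilevelRCPLD

/-! ### Limiting subdifferentials of Lipschitz functions and the sum rule at a minimizer. -/

section SubdifferentialCalculus

/-- `f` is Lipschitz on a neighbourhood of `x`. -/
def LipschitzNear {E : Type*} [PseudoMetricSpace E] (f : E → ℝ) (x : E) : Prop :=
  ∃ K : NNReal, ∃ U ∈ 𝓝 x, LipschitzOnWith K f U

namespace LipschitzNear

variable {E : Type*} [PseudoMetricSpace E] {f g : E → ℝ} {x : E}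

theorem eventually (h : LipschitzNear f x) : ∀ᶠ y in 𝓝 x, LipschitzNear f y := by
  obtain ⟨K, U, hU, hf⟩ := h
  filter_upwards [eventually_mem_nhds_iff.2 hU] with y hy using ⟨K, U, hy, hf⟩

theorem continuousAt (h : LipschitzNear f x) : ContinuousAt f x := by
  obtain ⟨K, U, hU, hf⟩ := h
  exact hf.continuousOn.continuousAt hU

theorem const_mul (h : LipschitzNear f x) (c : ℝ) : LipschitzNear (fun y => c * f y) x := by
  obtain ⟨K, U, hU, hf⟩ := h
  refine ⟨‖c‖₊ * K, U, hU, LipschitzOnWith.of_dist_le_mul fun y hy z hz => ?_⟩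
  have := hf.dist_le_mul y hy z hz
  rw [Real.dist_eq] at this ⊢
  rw [← mul_sub, abs_mul, NNReal.coe_mul, mul_assoc]
  exact mul_le_mul_of_nonneg_left this (abs_nonneg c)

theorem comp {F : Type*} [PseudoMetricSpace F] {g : F → E} {y : F} (h : LipschitzNear f (g y))
    (hg : LocallyLipschitz g) : LipschitzNear (fun y => f (g y)) y := by
  obtain ⟨K, U, hU, hf⟩ := h
  obtain ⟨M, W, hW, hgM⟩ := hg y
  have hc : ContinuousAt g y := hg.continuous.continuousAt
  exact ⟨K * M, W ∩ g ⁻¹' U, inter_mem hW (hc hU),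
    hf.comp (hgM.mono Set.inter_subset_left) fun z hz => hz.2⟩

theorem sub (hf : LipschitzNear f x) (hg : LipschitzNear g x) :
    LipschitzNear (fun y => f y - g y) x := by
  obtain ⟨K, U, hU, hf⟩ := hf
  obtain ⟨M, W, hW, hg⟩ := hg
  exact ⟨K + M, U ∩ W, inter_mem hU hW,
    (hf.mono Set.inter_subset_left).sub (hg.mono Set.inter_subset_right)⟩

theorem exists_common {ι : Type*} [Finite ι] {f : ι → E → ℝ} (h : ∀ i, LipschitzNear (f i) x) :
    ∃ K : NNReal, ∃ r > 0, ∀ i, LipschitzOnWith K (f i) (Metric.closedBall x r) := by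
  cases nonempty_fintype ι
  choose K U hU hf using h
  obtain ⟨r, hr, hrU⟩ := Metric.nhds_basis_closedBall.mem_iff.1 (iInter_mem.2 hU)
  refine ⟨∑ i, K i, r, hr, fun i => ((hf i).mono ?_).weaken ?_⟩
  · exact hrU.trans (Set.iInter_subset _ i)
  · exact Finset.single_le_sum (fun _ _ => zero_le) (Finset.mem_univ i)

end LipschitzNear

theorem _root_.LocallyLipschitz.lipschitzNear {E : Type*} [PseudoMetricSpace E] {f : E → ℝ}
    (h : LocallyLipschitz f) (x : E) : LipschitzNear f x := h x

variable {E : Type*} [NormedAddCommGroup E] [InnerProductSpace ℝ E]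

theorem mem_regularSubdiff_of_isLocalMin_add {φ ψ : E → ℝ} {ψ' x : E}
    (h : IsLocalMin (fun y => φ y + ψ y) x)
    (hψ : ∀ ε : ℝ, 0 < ε → ∀ᶠ y in 𝓝 x, ψ y - ψ x - ⟪ψ', y - x⟫ ≤ ε * ‖y - x‖) :
    -ψ' ∈ regularSubdiff φ x := by
  intro ε hε
  filter_upwards [h, hψ ε hε] with y hy hψy
  rw [inner_neg_left]
  linarith

/-- Test the subgradient inequality along the ray `x + t • ζ`: φ gains at least t‖ζ‖² up to an error
ε t‖ζ‖, but at most K t‖ζ‖. -/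
theorem norm_le_of_mem_regularSubdiff {φ : E → ℝ} {x ζ : E} {K : NNReal} {U : Set E}
    (hU : U ∈ 𝓝 x) (hφ : LipschitzOnWith K φ U) (hζ : ζ ∈ regularSubdiff φ x) : ‖ζ‖ ≤ K := by
  refine le_of_forall_pos_le_add fun ε hε => ?_
  by_cases h0 : ζ = 0
  · simp only [h0, norm_zero]; positivity
  have hζ0 : 0 < ‖ζ‖ := norm_pos_iff.2 h0
  have hlim : Tendsto (fun t : ℝ => x + t • ζ) (𝓝[>] 0) (𝓝 x) := by
    have : Tendsto (fun t : ℝ => x + t • ζ) (𝓝 0) (𝓝 (x + (0 : ℝ) • ζ)) :=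
      (Continuous.tendsto (by fun_prop) 0)
    simpa using this.mono_left nhdsWithin_le_nhds
  obtain ⟨t, ⟨ht1, ht2⟩, ht⟩ :=
    ((hlim.eventually ((hζ ε hε).and hU)).and self_mem_nhdsWithin).exists
  have ht : 0 < t := ht
  have hL := hφ.dist_le_mul _ ht2 _ (mem_of_mem_nhds hU)
  rw [Real.dist_eq, dist_eq_norm] at hL
  simp only [add_sub_cancel_left, norm_smul, Real.norm_eq_abs, abs_of_pos ht, inner_smul_right,
    real_inner_self_eq_norm_sq] at ht1 hL
  have h3 := (le_abs_self _).trans hL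
  have h4 : (t * ‖ζ‖) * ‖ζ‖ ≤ (t * ‖ζ‖) * (K + ε) := by nlinarith
  exact le_of_mul_le_mul_left h4 (by positivity)

theorem mem_limitingSubdiff_iff {φ : E → ℝ} {x ζ : E} :
    ζ ∈ limitingSubdiff φ x ↔ ∀ ε > 0, ∃ y ξ, ξ ∈ regularSubdiff φ y ∧ dist y x < ε ∧
      dist (φ y) (φ x) < ε ∧ dist ξ ζ < ε := by
  constructor
  · rintro ⟨xk, ξ, h, hx, hφ, hξ⟩ ε hε
    obtain ⟨k, ⟨h1, h2⟩, h3⟩ := (((Metric.tendsto_nhds.1 hx ε hε).and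
      (Metric.tendsto_nhds.1 hφ ε hε)).and (Metric.tendsto_nhds.1 hξ ε hε)).exists
    exact ⟨xk k, ξ k, h k, h1, h2, h3⟩
  · intro h
    choose y ξ h1 h2 h3 h4 using fun k : ℕ => h (1 / ((k : ℝ) + 1)) Nat.one_div_pos_of_nat
    have h0 := tendsto_one_div_add_atTop_nhds_zero_nat (𝕜 := ℝ)
    exact ⟨y, ξ, h1,
      tendsto_iff_dist_tendsto_zero.2 (squeeze_zero (fun _ => dist_nonneg) (fun k => (h2 k).le) h0),
      tendsto_iff_dist_tendsto_zero.2 (squeeze_zero (fun _ => dist_nonneg) (fun k => (h3 k).le) h0),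
      tendsto_iff_dist_tendsto_zero.2 (squeeze_zero (fun _ => dist_nonneg) (fun k => (h4 k).le) h0)⟩

/-- A diagonal argument, carried out through the ε-form of membership. This robustness is what
allows subgradients at the penalized minimizers to pass to the limit. -/
theorem mem_limitingSubdiff_of_tendsto {φ : E → ℝ} {x ζ : E} {xk ξ : ℕ → E}
    (hφ : ContinuousAt φ x) (h : ∀ k, ξ k ∈ limitingSubdiff φ (xk k))
    (hx : Tendsto xk atTop (𝓝 x)) (hξ : Tendsto ξ atTop (𝓝 ζ)) : ζ ∈ limitingSubdiff φ x := by
  refine mem_limitingSubdiff_iff.2 fun ε hε => ?_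
  obtain ⟨k, ⟨h1, h2⟩, h3⟩ := (((Metric.tendsto_nhds.1 hx _ (half_pos hε)).and
    (Metric.tendsto_nhds.1 (hφ.tendsto.comp hx) _ (half_pos hε))).and
      (Metric.tendsto_nhds.1 hξ _ (half_pos hε))).exists
  obtain ⟨y, η, hη, h4, h5, h6⟩ := mem_limitingSubdiff_iff.1 (h k) _ (half_pos hε)
  refine ⟨y, η, hη, ?_, ?_, ?_⟩
  · linarith [dist_triangle y (xk k) x]
  · have := dist_triangle (φ y) (φ (xk k)) (φ x)
    simp only [Function.comp] at h2
    linarith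
  · linarith [dist_triangle η (ξ k) ζ]

theorem LipschitzNear.exists_norm_le {φ : E → ℝ} {x : E} (h : LipschitzNear φ x) :
    ∃ K : ℝ, ∀ᶠ y in 𝓝 x, ∀ ζ ∈ limitingSubdiff φ y, ‖ζ‖ ≤ K := by
  obtain ⟨K, U, hU, hφ⟩ := h
  refine ⟨K, ?_⟩
  filter_upwards [eventually_mem_nhds_iff.2 hU] with y hy
  rintro ζ ⟨xk, ξ, h1, hx, -, hξ⟩
  refine le_of_tendsto hξ.norm ?_
  filter_upwards [hx.eventually (eventually_mem_nhds_iff.2 hy)] with k hk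
  exact norm_le_of_mem_regularSubdiff hk hφ (h1 k)

/-- The difference `ζ - φ'` is a regular subgradient of the zero function, which is 0-Lipschitz, so
its norm is at most 0. -/
theorem eq_of_mem_regularSubdiff_of_hasGradientAt [CompleteSpace E] {φ : E → ℝ} {x ζ φ' : E}
    (hφ : HasGradientAt φ φ' x) (hζ : ζ ∈ regularSubdiff φ x) : ζ = φ' := by
  have hmem : ζ - φ' ∈ regularSubdiff (fun _ : E => (0 : ℝ)) x := by
    intro ε hε
    have h1 := (hasGradientAt_iff_isLittleO.1 hφ).def (half_pos hε)
    filter_upwards [h1, hζ _ (half_pos hε)] with y hy hy'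
    have := (le_abs_self _).trans hy
    rw [inner_sub_left]
    linarith
  have := norm_le_of_mem_regularSubdiff (K := 0) univ_mem
    ((LipschitzWith.const (0 : ℝ)).lipschitzOnWith) hmem
  simpa [sub_eq_zero] using this

theorem _root_.ContDiff.continuous_gradient [CompleteSpace E] {φ : E → ℝ} (hφ : ContDiff ℝ 1 φ) :
    Continuous (gradient φ) :=
  (InnerProductSpace.toDual ℝ E).symm.continuous.comp (hφ.continuous_fderiv one_ne_zero)

theorem eq_gradient_of_mem_limitingSubdiff [CompleteSpace E] {φ : E → ℝ} {x ζ : E}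
    (hφ : ContDiff ℝ 1 φ) (hζ : ζ ∈ limitingSubdiff φ x) : ζ = gradient φ x := by
  obtain ⟨xk, ξ, h, hx, -, hξ⟩ := hζ
  have hξ' : ξ = fun k => gradient φ (xk k) := funext fun k =>
    eq_of_mem_regularSubdiff_of_hasGradientAt
      ((hφ.differentiable one_ne_zero).differentiableAt.hasGradientAt) (h k)
  rw [hξ'] at hξ
  exact tendsto_nhds_unique hξ ((hφ.continuous_gradient.tendsto x).comp hx)

theorem inv_smul_mem_regularSubdiff {φ : E → ℝ} {x ζ : E} {c : ℝ} (hc : 0 < c)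
    (hζ : ζ ∈ regularSubdiff (fun y => c * φ y) x) : c⁻¹ • ζ ∈ regularSubdiff φ x := by
  intro ε hε
  filter_upwards [hζ (c * ε) (by positivity)] with y hy
  rw [inner_smul_left]
  simp only [conj_trivial]
  have h1 := mul_le_mul_of_nonneg_left hy (inv_pos.2 hc).le
  calc -(ε * ‖y - x‖) = c⁻¹ * -(c * ε * ‖y - x‖) := by field_simp
    _ ≤ _ := h1
    _ = _ := by field_simp

theorem inv_smul_mem_limitingSubdiff {φ : E → ℝ} {x ζ : E} {c : ℝ} (hc : 0 < c)
    (hζ : ζ ∈ limitingSubdiff (fun y => c * φ y) x) : c⁻¹ • ζ ∈ limitingSubdiff φ x := by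
  obtain ⟨xk, ξ, h, hx, hφ, hξ⟩ := hζ
  refine ⟨xk, fun k => c⁻¹ • ξ k, fun k => inv_smul_mem_regularSubdiff hc (h k), hx, ?_,
    hξ.const_smul _⟩
  simpa [hc.ne'] using hφ.const_mul c⁻¹

theorem mem_limitingSubdiff_of_eventually {φ : E → ℝ} {x ζ : E} {xk ξ : ℕ → E}
    (hφ : ContinuousAt φ x) (h : ∀ᶠ k in atTop, ξ k ∈ regularSubdiff φ (xk k))
    (hx : Tendsto xk atTop (𝓝 x)) (hξ : Tendsto ξ atTop (𝓝 ζ)) : ζ ∈ limitingSubdiff φ x := by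
  obtain ⟨N, hN⟩ := eventually_atTop.1 h
  have hx' := (tendsto_add_atTop_iff_nat N).2 hx
  exact ⟨fun k => xk (k + N), fun k => ξ (k + N), fun k => hN _ (by lia), hx',
    hφ.tendsto.comp hx', (tendsto_add_atTop_iff_nat N).2 hξ⟩

theorem eventually_mul_norm_sq_sub_le (j : ℝ) (w x : E) : ∀ ε : ℝ, 0 < ε → ∀ᶠ y in 𝓝 x,
    j * ‖y - w‖ ^ 2 - j * ‖x - w‖ ^ 2 - ⟪(2 * j) • (x - w), y - x⟫ ≤ ε * ‖y - x‖ := by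
  intro ε hε
  have hlim : Tendsto (fun y : E => j * ‖y - x‖) (𝓝 x) (𝓝 0) := by
    have : Tendsto (fun y : E => j * ‖y - x‖) (𝓝 x) (𝓝 (j * ‖x - x‖)) :=
      Continuous.tendsto (by fun_prop) x
    simpa using this
  filter_upwards [hlim.eventually (gt_mem_nhds hε)] with y hy
  have h1 : ‖y - w‖ ^ 2 = ‖y - x‖ ^ 2 + 2 * ⟪x - w, y - x⟫ + ‖x - w‖ ^ 2 := by
    have h2 := norm_add_sq_real (y - x) (x - w)
    rwa [sub_add_sub_cancel, real_inner_comm] at h2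
  rw [h1, real_inner_smul_left]
  nlinarith [norm_nonneg (y - x)]

variable [FiniteDimensional ℝ E]

/-- Decoupling of a local minimum of a sum of Lipschitz functions: near-minimizers of the
separated sum with a quadratic coupling term. -/
theorem exists_decoupled_minimizer {ι : Type*} [Fintype ι] {f : ι → E → ℝ} {x : E} {K : NNReal}
    {r : ℝ} (hr : 0 < r) (hf : ∀ i, LipschitzOnWith K (f i) (Metric.closedBall x r))
    (hmin : ∀ y ∈ Metric.closedBall x r, ∑ i, f i x ≤ ∑ i, f i y) (j : ℝ) :
    ∃ (w : E) (y : ι → E), w ∈ Metric.closedBall x r ∧ (∀ i, y i ∈ Metric.closedBall x r) ∧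
      j * ∑ i, ‖y i - w‖ ^ 2 + ‖w - x‖ ^ 2 ≤ K * ∑ i, ‖y i - w‖ ∧
      ∀ w' ∈ Metric.closedBall x r, ∀ y' : ι → E, (∀ i, y' i ∈ Metric.closedBall x r) →
        ∑ i, f i (y i) + j * ∑ i, ‖y i - w‖ ^ 2 + ‖w - x‖ ^ 2 ≤
          ∑ i, f i (y' i) + j * ∑ i, ‖y' i - w'‖ ^ 2 + ‖w' - x‖ ^ 2 := by
  have : ProperSpace E := FiniteDimensional.proper ℝ E
  have hx : x ∈ Metric.closedBall x r := Metric.mem_closedBall_self hr.le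
  let C : Set (E × (ι → E)) :=
    Metric.closedBall x r ×ˢ Set.pi Set.univ fun _ => Metric.closedBall x r
  have hC : IsCompact C :=
    (isCompact_closedBall x r).prod (isCompact_univ_pi fun _ => isCompact_closedBall x r)
  have hne : C.Nonempty := ⟨(x, fun _ => x), hx, fun _ _ => hx⟩
  have hcont : ContinuousOn (fun p : E × (ι → E) =>
      ∑ i, f i (p.2 i) + j * ∑ i, ‖p.2 i - p.1‖ ^ 2 + ‖p.1 - x‖ ^ 2) C := by
    refine ContinuousOn.add (ContinuousOn.add (continuousOn_finsetSum _ fun i _ => ?_) ?_) ?_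
    · exact (hf i).continuousOn.comp (by fun_prop) fun p hp => hp.2 i trivial
    · exact Continuous.continuousOn (by fun_prop)
    · exact Continuous.continuousOn (by fun_prop)
  obtain ⟨⟨w, y⟩, ⟨hw, hy⟩, hm⟩ := hC.exists_isMinOn hne hcont
  refine ⟨w, y, hw, fun i => hy i trivial, ?_, fun w' hw' y' hy' => hm (show (w', y') ∈ C from
    ⟨hw', fun i _ => hy' i⟩)⟩
  -- Compare with all copies placed at `x`. Moving each `y i` to the common point `w` then costs at
  -- most the Lipschitz bound, and minimality of `x` applies at `w`.
  have h1 := hm (show (x, fun _ => x) ∈ C from ⟨hx, fun _ _ => hx⟩)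
  simp only [Set.mem_ofPred_eq, sub_self, norm_zero, ne_eq, OfNat.ofNat_ne_zero, not_false_eq_true,
    zero_pow, Finset.sum_const_zero, mul_zero, add_zero] at h1
  have h2 : ∑ i, f i w - ∑ i, f i (y i) ≤ K * ∑ i, ‖y i - w‖ := by
    rw [← Finset.sum_sub_distrib, Finset.mul_sum]
    refine Finset.sum_le_sum fun i _ => ?_
    have := (hf i).dist_le_mul _ hw _ (hy i trivial)
    rw [dist_comm w, Real.dist_eq] at this
    rw [← dist_eq_norm (y i)]
    exact (le_abs_self _).trans this
  linarith [hmin w hw]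

/-- The sum rule at a minimizer on a ball. -/
theorem exists_limitingSubdiff_sum_eq_zero_of_closedBall {ι : Type*} [Fintype ι] {f : ι → E → ℝ}
    {x : E} {K : NNReal} {r : ℝ} (hr : 0 < r)
    (hf : ∀ i, LipschitzOnWith K (f i) (Metric.closedBall x r))
    (hmin : ∀ y ∈ Metric.closedBall x r, ∑ i, f i x ≤ ∑ i, f i y) :
    ∃ ξ : ι → E, (∀ i, ξ i ∈ limitingSubdiff (f i) x) ∧ ∑ i, ξ i = 0 := by
  classical
  have : ProperSpace E := FiniteDimensional.proper ℝ E
  have hj : ∀ k : ℕ, (0 : ℝ) < (k : ℝ) + 1 := fun k => by positivity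
  choose w y hw hy hbd hm using fun k : ℕ => exists_decoupled_minimizer hr hf hmin ((k : ℝ) + 1)
  set M : ℝ := Fintype.card ι * (K : ℝ) ^ 2 with hM
  have hM0 : 0 ≤ M := by positivity
  -- Multiply the decoupling bound by 2(k+1) and complete the square. This bounds (k+1)‖y k i - w k‖
  -- uniformly in k, hence the subgradients `ξ` below, and forces all points to converge to `x`.
  have hkey : ∀ k : ℕ, ((k : ℝ) + 1) ^ 2 * ∑ i, ‖y k i - w k‖ ^ 2 +
      2 * ((k : ℝ) + 1) * ‖w k - x‖ ^ 2 ≤ M := by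
    intro k
    have h1 : 2 * ((k : ℝ) + 1) * (K * ∑ i, ‖y k i - w k‖) ≤
        M + ((k : ℝ) + 1) ^ 2 * ∑ i, ‖y k i - w k‖ ^ 2 := by
      have h2 : M = ∑ _i : ι, (K : ℝ) ^ 2 := by simp [hM]
      rw [h2, Finset.mul_sum, Finset.mul_sum, Finset.mul_sum, ← Finset.sum_add_distrib]
      refine Finset.sum_le_sum fun i _ => ?_
      nlinarith [sq_nonneg ((K : ℝ) - ((k : ℝ) + 1) * ‖y k i - w k‖)]
    have h3 := mul_le_mul_of_nonneg_left (hbd k) (by have := hj k; positivity :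
      (0 : ℝ) ≤ 2 * ((k : ℝ) + 1))
    nlinarith
  have hsq : ∀ (k : ℕ) i, (((k : ℝ) + 1) * ‖y k i - w k‖) ^ 2 ≤ M := by
    intro k i
    have h1 : ‖y k i - w k‖ ^ 2 ≤ ∑ i, ‖y k i - w k‖ ^ 2 :=
      Finset.single_le_sum (f := fun i => ‖y k i - w k‖ ^ 2) (fun _ _ => by positivity)
        (Finset.mem_univ i)
    have h2 := mul_le_mul_of_nonneg_left h1 (sq_nonneg ((k : ℝ) + 1))
    have h3 : 0 ≤ 2 * ((k : ℝ) + 1) * ‖w k - x‖ ^ 2 := by have := hj k; positivity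
    rw [mul_pow]
    linarith [hkey k]
  have hwx : ∀ k, ‖w k - x‖ ^ 2 ≤ M / ((k : ℝ) + 1) := by
    intro k
    rw [le_div_iff₀ (hj k)]
    have h1 : 0 ≤ ((k : ℝ) + 1) ^ 2 * ∑ i, ‖y k i - w k‖ ^ 2 := by positivity
    have h2 : 0 ≤ ((k : ℝ) + 1) * ‖w k - x‖ ^ 2 := by have := hj k; positivity
    linarith [hkey k]
  have hyw : ∀ k i, ‖y k i - w k‖ ^ 2 ≤ M / ((k : ℝ) + 1) := by
    intro k i
    rw [le_div_iff₀ (hj k)]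
    have h1 := hsq k i
    rw [mul_pow] at h1
    have h2 : 0 ≤ ‖y k i - w k‖ ^ 2 := by positivity
    have h3 : (0 : ℝ) ≤ k := by positivity
    nlinarith [mul_nonneg h3 h2, mul_nonneg (mul_nonneg h3 h3) h2]
  have hlim : Tendsto (fun k : ℕ => √(M / ((k : ℝ) + 1))) atTop (𝓝 0) := by
    have h1 : Tendsto (fun k : ℕ => M / ((k : ℝ) + 1)) atTop (𝓝 0) := by
      simpa [div_eq_mul_inv] using (tendsto_one_div_add_atTop_nhds_zero_nat (𝕜 := ℝ)).const_mul M
    simpa using h1.sqrt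
  have hwlim : Tendsto w atTop (𝓝 x) :=
    tendsto_iff_norm_sub_tendsto_zero.2
      (squeeze_zero (fun _ => norm_nonneg _) (fun k => Real.le_sqrt_of_sq_le (hwx k)) hlim)
  have hylim : ∀ i, Tendsto (fun k => y k i) atTop (𝓝 x) := by
    intro i
    have h1 : Tendsto (fun k => y k i - w k) atTop (𝓝 0) :=
      tendsto_zero_iff_norm_tendsto_zero.2
        (squeeze_zero (fun _ => norm_nonneg _) (fun k => Real.le_sqrt_of_sq_le (hyw k i)) hlim)
    simpa using h1.add hwlim
  -- The negative gradient of the coupling term in the i-th copy. Varying only `y k i` makes it a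
  -- regular subgradient of `f i`; varying only `w k` shows that the sum over `i` is -2(w k - x),
  -- which tends to 0.
  let ξ : ℕ → ι → E := fun k i => -((2 * ((k : ℝ) + 1)) • (y k i - w k))
  have hξbd : ∀ k, ξ k ∈ Metric.closedBall (0 : ι → E) (2 * √M) := by
    intro k
    rw [mem_closedBall_zero_iff, pi_norm_le_iff_of_nonneg (by positivity)]
    intro i
    have h1 := Real.le_sqrt_of_sq_le (hsq k i)
    simp only [ξ, norm_neg, norm_smul, Real.norm_eq_abs]
    rw [abs_of_pos (by have := hj k; positivity)]
    linarith
  obtain ⟨ζ, -, θ, hθ, hζ⟩ := (isCompact_closedBall (0 : ι → E) (2 * √M)).tendsto_subseq hξbd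
  have hball : Metric.ball x r ∈ 𝓝 x := Metric.ball_mem_nhds x hr
  have hξi : ∀ i, ∀ᶠ k in atTop, ξ k i ∈ regularSubdiff (f i) (y k i) := by
    intro i
    filter_upwards [(hylim i).eventually hball] with k hk
    refine mem_regularSubdiff_of_isLocalMin_add
      (ψ := fun z => ((k : ℝ) + 1) * ‖z - w k‖ ^ 2) ?_ (eventually_mul_norm_sq_sub_le _ _ _)
    filter_upwards [Metric.isOpen_ball.mem_nhds hk] with z hz
    have h1 := hm k (w k) (hw k) (Function.update (y k) i z) fun i' => by
      by_cases h : i' = i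
      · subst h; simpa using Metric.ball_subset_closedBall hz
      · simpa [h] using hy k i'
    have h2 : ∀ F : ι → E → ℝ, ∑ i', F i' (Function.update (y k) i z i') - ∑ i', F i' (y k i') =
        F i z - F i (y k i) := by
      intro F
      rw [← Finset.sum_sub_distrib, Finset.sum_eq_single i]
      · simp
      · intro b _ hb; simp [hb]
      · simp
    have h3 := h2 f
    have h4 := h2 fun _ z => ‖z - w k‖ ^ 2
    have h5 := congrArg (((k : ℝ) + 1) * ·) h4
    simp only [mul_sub] at h5
    linarith
  have hsum : ∀ᶠ k in atTop, ∑ i, ξ k i = -((2 : ℝ) • (w k - x)) := by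
    filter_upwards [hwlim.eventually hball] with k hk
    have h1 : IsLocalMin (fun z => ((k : ℝ) + 1) * ∑ i, ‖y k i - z‖ ^ 2 + 1 * ‖z - x‖ ^ 2)
        (w k) := by
      filter_upwards [Metric.isOpen_ball.mem_nhds hk] with z hz
      have h1 := hm k z (Metric.ball_subset_closedBall hz) (y k) (hy k)
      linarith
    have h2 := mem_regularSubdiff_of_isLocalMin_add h1 (eventually_mul_norm_sq_sub_le _ _ _)
    have h3 : HasGradientAt (fun z => ((k : ℝ) + 1) * ∑ i, ‖y k i - z‖ ^ 2) (∑ i, ξ k i) (w k) := by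
      rw [hasGradientAt_iff_hasFDerivAt]
      have h4 : ∀ i ∈ Finset.univ, HasFDerivAt (fun z => ‖y k i - z‖ ^ 2)
          (2 • (innerSL ℝ (y k i - w k)).comp (-ContinuousLinearMap.id ℝ E)) (w k) := fun i _ =>
        ((hasFDerivAt_id (w k)).const_sub (y k i)).norm_sq
      refine ((HasFDerivAt.fun_sum h4).const_mul ((k : ℝ) + 1)).congr_fderiv ?_
      ext v
      simp only [ξ, map_sum, smul_apply, sum_apply,
        Finset.smul_sum]
      refine Finset.sum_congr rfl fun i _ => ?_
      simp
      ring
    have h5 := eq_of_mem_regularSubdiff_of_hasGradientAt h3 h2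
    rw [← h5, mul_one]
  refine ⟨ζ, fun i => ?_, ?_⟩
  · exact mem_limitingSubdiff_of_eventually ((hf i).continuousOn.continuousAt
      (Metric.closedBall_mem_nhds x hr)) (hθ.tendsto_atTop.eventually (hξi i))
      ((hylim i).comp hθ.tendsto_atTop) (tendsto_pi_nhds.1 hζ i)
  · have h1 : Tendsto (fun k => ∑ i, ξ (θ k) i) atTop (𝓝 (∑ i, ζ i)) :=
      tendsto_finsetSum _ fun i _ => tendsto_pi_nhds.1 hζ i
    have h2 : Tendsto (fun k => -((2 : ℝ) • (w (θ k) - x))) atTop (𝓝 0) := by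
      simpa using (((hwlim.comp hθ.tendsto_atTop).sub_const x).const_smul (2 : ℝ)).neg
    exact tendsto_nhds_unique h1 (h2.congr' ((hθ.tendsto_atTop.eventually hsum).mono
      fun k hk => hk.symm))

/-- The limiting sum rule at a local minimizer of a finite sum of Lipschitz functions. -/
theorem exists_limitingSubdiff_sum_eq_zero {ι : Type*} [Fintype ι] {f : ι → E → ℝ} {x : E}
    (hf : ∀ i, LipschitzNear (f i) x) (hmin : IsLocalMin (fun y => ∑ i, f i y) x) :
    ∃ ξ : ι → E, (∀ i, ξ i ∈ limitingSubdiff (f i) x) ∧ ∑ i, ξ i = 0 := by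
  obtain ⟨K, r, hr, hK⟩ := LipschitzNear.exists_common hf
  obtain ⟨r', hr', hmin'⟩ := Metric.nhds_basis_closedBall.mem_iff.1 hmin
  exact exists_limitingSubdiff_sum_eq_zero_of_closedBall (lt_min hr hr')
    (fun i => (hK i).mono (Metric.closedBall_subset_closedBall (min_le_left _ _)))
    fun y hy => hmin' (Metric.closedBall_subset_closedBall (min_le_right _ _) hy)

/-- The functions φ and -φ add up to a constant, so every point minimizes the sum and the sum rule
yields a subgradient of φ. -/
theorem LipschitzNear.limitingSubdiff_nonempty {φ : E → ℝ} {x : E} (h : LipschitzNear φ x) :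
    (limitingSubdiff φ x).Nonempty := by
  obtain ⟨ξ, hξ, -⟩ := exists_limitingSubdiff_sum_eq_zero
    (f := fun b : Bool => if b then φ else fun y => -1 * φ y) (x := x)
    (by rintro (_ | _); exacts [by simpa using h.const_mul (-1), by simpa using h])
    (Eventually.of_forall fun y => by simp)
  exact ⟨ξ true, by simpa using hξ true⟩

end SubdifferentialCalculus
-- Quadratic penalization and its first order conditions.
section Penalization

/-- Replacing a squared residual by its quadratic upper model keeps a local minimizer. -/
theorem isLocalMin_linearized {E : Type*} [NormedAddCommGroup E] {τ : Type*} [Fintype τ]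
    {φ : E → ℝ} {a : τ → E → ℝ}
    {R : (τ → ℝ) → τ → ℝ} {x z : E} {k : ℝ} (hk : 0 ≤ k)
    (hR : ∀ t t', ∑ i, R t' i ^ 2 ≤ ∑ i, (t' i - t i + R t i) ^ 2)
    (ha : ∀ i, LipschitzNear (a i) z)
    (hmin : IsLocalMin (fun y => φ y + 1 / 2 * ‖y - x‖ ^ 2 +
      k * (1 / 2 * ∑ i, R (fun i => a i y) i ^ 2)) z) :
    ∃ C : ℝ, IsLocalMin (fun y => φ y + ∑ i, (k * R (fun i => a i z) i) * a i y +
      (1 / 2 * ‖y - x‖ ^ 2 + C * ‖y - z‖ ^ 2)) z := by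
  obtain ⟨K, r, hr, hK⟩ := LipschitzNear.exists_common ha
  -- Expanding the squares in `hR` leaves the linear term and the sum of (a i y - a i z)², which the
  -- common Lipschitz constant bounds by card τ · K²‖y - z‖². This extra quadratic has zero gradient
  -- at `z`.
  refine ⟨k * (1 / 2 * (Fintype.card τ * (K : ℝ) ^ 2)), ?_⟩
  filter_upwards [hmin, Metric.closedBall_mem_nhds z hr] with y hy hyr
  set t : τ → ℝ := fun i => a i z
  have h1 := hR t fun i => a i y
  have h2 : ∑ i, (a i y - t i + R t i) ^ 2 ≤
      ∑ i, R t i ^ 2 + (2 * (∑ i, R t i * a i y - ∑ i, R t i * a i z) +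
        (Fintype.card τ * (K : ℝ) ^ 2) * ‖y - z‖ ^ 2) := by
    have h3 : (Fintype.card τ * (K : ℝ) ^ 2) * ‖y - z‖ ^ 2 =
        ∑ _i : τ, (K * ‖y - z‖) ^ 2 := by simp; ring
    rw [h3, ← Finset.sum_sub_distrib, Finset.mul_sum, ← Finset.sum_add_distrib,
      ← Finset.sum_add_distrib]
    refine Finset.sum_le_sum fun i _ => ?_
    have h4 := (hK i).dist_le_mul y hyr z (Metric.mem_closedBall_self hr.le)
    rw [Real.dist_eq, dist_eq_norm] at h4
    have h5 : (a i y - a i z) ^ 2 ≤ (K * ‖y - z‖) ^ 2 := sq_le_sq' (by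
      linarith [neg_abs_le (a i y - a i z)]) ((le_abs_self _).trans h4)
    have h6 : t i = a i z := rfl
    rw [h6]
    nlinarith
  have h3 := mul_le_mul_of_nonneg_left (h1.trans h2) hk
  simp only [mul_assoc, ← Finset.mul_sum, sub_self, norm_zero]
  change φ z + 1 / 2 * ‖z - x‖ ^ 2 + k * (1 / 2 * ∑ i, R t i ^ 2) ≤ _ at hy
  nlinarith

variable {E : Type*} [NormedAddCommGroup E] [InnerProductSpace ℝ E]

theorem hasGradientAt_half_norm_sq_sub_add [CompleteSpace E] (C : ℝ) (x₀ x : E) :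
    HasGradientAt (fun y => 1 / 2 * ‖y - x₀‖ ^ 2 + C * ‖y - x‖ ^ 2) (x - x₀) x := by
  rw [hasGradientAt_iff_hasFDerivAt]
  refine (((((hasFDerivAt_id x).sub_const x₀).norm_sq).const_mul (1 / 2 : ℝ)).add
    ((((hasFDerivAt_id x).sub_const x).norm_sq).const_mul C)).congr_fderiv ?_
  ext v
  simp

variable [FiniteDimensional ℝ E]

/-- First order condition at a local minimizer of a weighted sum of Lipschitz functions plus
a quadratic. -/
theorem exists_limitingSubdiff_of_isLocalMin {τ : Type*} [Fintype τ] {φ : E → ℝ}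
    {a : τ → E → ℝ} {x x₀ : E} {c : τ → ℝ} {C : ℝ} (hφ : LipschitzNear φ x)
    (ha : ∀ i, LipschitzNear (a i) x)
    (hmin : IsLocalMin (fun y => φ y + ∑ i, c i * a i y +
      (1 / 2 * ‖y - x₀‖ ^ 2 + C * ‖y - x‖ ^ 2)) x) :
    ∃ ξ ∈ limitingSubdiff φ x, ∃ ω : τ → E,
      (∀ i, ω i ∈ limitingSubdiff (fun y => c i * a i y) x) ∧
      ξ + ∑ i, ω i + (x - x₀) = 0 := by
  have : CompleteSpace E := FiniteDimensional.complete ℝ E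
  let ψ : E → ℝ := fun y => 1 / 2 * ‖y - x₀‖ ^ 2 + C * ‖y - x‖ ^ 2
  have hψ : ContDiff ℝ 1 ψ :=
    (contDiff_const.mul ((contDiff_id.sub contDiff_const).norm_sq ℝ)).add
      (contDiff_const.mul ((contDiff_id.sub contDiff_const).norm_sq ℝ))
  -- Summands: `none` is the quadratic, `some none` is φ, and `some (some i)` is the i-th weighted
  -- function.
  let F : Option (Option τ) → E → ℝ := fun o =>
    o.elim ψ fun o => o.elim φ fun i y => c i * a i y
  obtain ⟨ζ, hζ, hsum⟩ := exists_limitingSubdiff_sum_eq_zero (f := F) (x := x)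
    (by
      rintro (_ | _ | i)
      exacts [hψ.locallyLipschitz.lipschitzNear x, hφ, (ha i).const_mul (c i)])
    (hmin.congr (Eventually.of_forall fun y => by
      simp only [Fintype.sum_option, F, Option.elim, ψ]; ring))
  refine ⟨ζ (some none), hζ (some none), fun i => ζ (some (some i)),
    fun i => hζ (some (some i)), ?_⟩
  have h1 : ζ none = x - x₀ := by
    rw [eq_gradient_of_mem_limitingSubdiff hψ (hζ none)]
    exact (hasGradientAt_half_norm_sq_sub_add C x₀ x).gradient
  simp only [Fintype.sum_option, h1] at hsum
  rw [← hsum]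
  abel

theorem eq_smul_gradient_of_mem_limitingSubdiff {a : E → ℝ} {x ω : E} {c : ℝ}
    (ha : ContDiff ℝ 1 a) (hω : ω ∈ limitingSubdiff (fun y => c * a y) x) :
    haveI := FiniteDimensional.complete ℝ E
    ω = c • gradient a x := by
  have : CompleteSpace E := FiniteDimensional.complete ℝ E
  rw [eq_gradient_of_mem_limitingSubdiff (contDiff_const.mul ha) hω]
  have h1 : HasFDerivAt (fun y => c * a y) (c • fderiv ℝ a x) x :=
    ((ha.differentiable one_ne_zero).differentiableAt.hasFDerivAt).const_mul c
  have h2 : HasGradientAt (fun y => c * a y) (c • gradient a x) x := by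
    rw [hasGradientAt_iff_hasFDerivAt]
    simpa [gradient] using h1
  exact h2.gradient

/-- Nonnegativity is essential, since limiting subdifferentials do not commute with -1. For `c = 0`
some subgradient must still be exhibited, which uses nonemptiness. -/
theorem exists_eq_smul_of_mem_limitingSubdiff {a : E → ℝ} {x ω : E} {c : ℝ} (hc : 0 ≤ c)
    (ha : LipschitzNear a x) (hω : ω ∈ limitingSubdiff (fun y => c * a y) x) :
    ∃ v ∈ limitingSubdiff a x, ω = c • v := by
  have : CompleteSpace E := FiniteDimensional.complete ℝ E
  rcases hc.eq_or_lt with rfl | hc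
  · obtain ⟨v, hv⟩ := ha.limitingSubdiff_nonempty
    refine ⟨v, hv, ?_⟩
    simp only [zero_mul] at hω
    rw [eq_gradient_of_mem_limitingSubdiff contDiff_const hω]
    simp
  · exact ⟨c⁻¹ • ω, inv_smul_mem_limitingSubdiff hc hω, by rw [smul_inv_smul₀ hc.ne']⟩

/-- Minimizers of the penalized problems converge to the local solution. -/
theorem exists_tendsto_isLocalMin_penalized {φ ρ : E → ℝ} {x : E}
    (hφ : ∀ᶠ y in 𝓝 x, ContinuousAt φ y) (hρ : ∀ᶠ y in 𝓝 x, ContinuousAt ρ y)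
    (hρ0 : ∀ y, 0 ≤ ρ y) (hρx : ρ x = 0) (hmin : ∀ᶠ y in 𝓝 x, ρ y = 0 → φ x ≤ φ y) :
    ∃ z : ℕ → E, Tendsto z atTop (𝓝 x) ∧
      ∀ᶠ k : ℕ in atTop, IsLocalMin (fun y => φ y + 1 / 2 * ‖y - x‖ ^ 2 + k * ρ y) (z k) := by
  have : ProperSpace E := FiniteDimensional.proper ℝ E
  obtain ⟨r, hr, hB⟩ := Metric.nhds_basis_closedBall.mem_iff.1 (hφ.and (hρ.and hmin))
  have hcomp : IsCompact (Metric.closedBall x r) := isCompact_closedBall x r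
  have hx : x ∈ Metric.closedBall x r := Metric.mem_closedBall_self hr.le
  have hφc : ContinuousOn φ (Metric.closedBall x r) := fun y hy =>
    (hB hy).1.continuousWithinAt
  have hρc : ContinuousOn ρ (Metric.closedBall x r) := fun y hy =>
    (hB hy).2.1.continuousWithinAt
  have hex : ∀ k : ℕ, ∃ z ∈ Metric.closedBall x r,
      IsMinOn (fun y => φ y + 1 / 2 * ‖y - x‖ ^ 2 + k * ρ y) (Metric.closedBall x r) z :=
    fun k => hcomp.exists_isMinOn ⟨x, hx⟩ (by fun_prop)
  choose z hz hm using hex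
  obtain ⟨m, hmB, hmm⟩ := hcomp.exists_isMinOn ⟨x, hx⟩ hφc
  have hle : ∀ k : ℕ, φ (z k) + 1 / 2 * ‖z k - x‖ ^ 2 + k * ρ (z k) ≤ φ x := fun k => by
    have := hm k hx
    simpa [hρx] using this
  have hlim : Tendsto z atTop (𝓝 x) := by
    -- At a cluster point `y`, kρ stays bounded along the minimizers, so ρ y = 0. Then φ y + ½‖y -
    -- x‖² ≤ φ x ≤ φ y, and the proximal term forces y = x.
    refine hcomp.tendsto_nhds_of_unique_mapClusterPt (Eventually.of_forall hz) fun y hy hcl => ?_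
    obtain ⟨θ, hθ, hθy⟩ := hcl.tendsto_subseq
    have hφy : Tendsto (fun k => φ (z (θ k))) atTop (𝓝 (φ y)) := (hB hy).1.tendsto.comp hθy
    have hρy : Tendsto (fun k => ρ (z (θ k))) atTop (𝓝 (ρ y)) := (hB hy).2.1.tendsto.comp hθy
    have hny : Tendsto (fun k => 1 / 2 * ‖z (θ k) - x‖ ^ 2) atTop (𝓝 (1 / 2 * ‖y - x‖ ^ 2)) :=
      (((hθy.sub_const x).norm).pow 2).const_mul _
    have hρ0y : ρ y ≤ 0 := by
      have h1 : Tendsto (fun k => (φ x - φ m) * ((θ k : ℕ) : ℝ)⁻¹) atTop (𝓝 ((φ x - φ m) * 0)) :=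
        ((tendsto_inv_atTop_zero.comp tendsto_natCast_atTop_atTop).comp
          hθ.tendsto_atTop).const_mul _
      rw [mul_zero] at h1
      refine le_of_tendsto_of_tendsto hρy h1 ?_
      filter_upwards [hθ.tendsto_atTop.eventually (eventually_gt_atTop 0)] with k hk
      have hk' : (0 : ℝ) < (θ k : ℕ) := by exact_mod_cast hk
      rw [← div_eq_mul_inv, le_div_iff₀ hk']
      have h2 := hle (θ k)
      have h3 := hmm (hz (θ k))
      simp only [Set.mem_ofPred_eq] at h3
      nlinarith [sq_nonneg ‖z (θ k) - x‖]
    have h1 := (hB hy).2.2 (le_antisymm hρ0y (hρ0 y))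
    have h2 : φ y + 1 / 2 * ‖y - x‖ ^ 2 ≤ φ x := by
      refine le_of_tendsto (hφy.add hny) (Eventually.of_forall fun k => ?_)
      have h3 := hle (θ k)
      have h4 : 0 ≤ ((θ k : ℕ) : ℝ) * ρ (z (θ k)) := mul_nonneg (Nat.cast_nonneg _) (hρ0 _)
      linarith
    have h3 : ‖y - x‖ ^ 2 = 0 := le_antisymm (by linarith) (sq_nonneg _)
    simpa [sub_eq_zero] using h3
  refine ⟨z, hlim, ?_⟩
  filter_upwards [hlim.eventually (Metric.ball_mem_nhds x hr)] with k hk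
  exact (hm k).isLocalMin (Filter.mem_of_superset (Metric.isOpen_ball.mem_nhds hk)
    Metric.ball_subset_closedBall)

end Penalization

/-! ### Nearest-point residuals for the complementarity set. -/

section Residuals

/-- First component of a projection residual of `(a, b)` with respect to
`{(p, q) | 0 ≤ p ⊥ q ≥ 0}`. -/
noncomputable def compResidualLeft (a b : ℝ) : ℝ := if b ≤ a then min a 0 else a

/-- Second component of a projection residual of `(a, b)` with respect to
`{(p, q) | 0 ≤ p ⊥ q ≥ 0}`. -/
noncomputable def compResidualRight (a b : ℝ) : ℝ := if b ≤ a then b else min b 0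

/-- The residuals jump across a = b > 0, where two nearest points compete. The right-hand side shows
that their squared norm is nevertheless continuous. -/
theorem compResidual_sq_add_sq (a b : ℝ) :
    compResidualLeft a b ^ 2 + compResidualRight a b ^ 2 =
      min a b ^ 2 + min (max a b) 0 ^ 2 := by
  unfold compResidualLeft compResidualRight
  split_ifs with h
  · rw [min_eq_right h, max_eq_left h, add_comm]
  · rw [min_eq_left (not_le.1 h).le, max_eq_right (not_le.1 h).le]

theorem compResidual_sq_add_sq_le {a b p q : ℝ} (hp : 0 ≤ p) (hq : 0 ≤ q) (hpq : p * q = 0) :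
    compResidualLeft a b ^ 2 + compResidualRight a b ^ 2 ≤ (a - p) ^ 2 + (b - q) ^ 2 := by
  unfold compResidualLeft compResidualRight
  rcases mul_eq_zero.1 hpq with rfl | rfl <;> split_ifs with h <;>
    rcases le_total a 0 with ha | ha <;> rcases le_total b 0 with hb | hb <;>
    simp only [ha, hb, min_eq_left, min_eq_right] <;> nlinarith

theorem compResidual_projection (a b : ℝ) :
    0 ≤ a - compResidualLeft a b ∧ 0 ≤ b - compResidualRight a b ∧
      (a - compResidualLeft a b) * (b - compResidualRight a b) = 0 := by
  unfold compResidualLeft compResidualRight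
  split_ifs with h <;> simp

/-- The origin of the M-condition: if the larger coordinate is nonnegative its residual vanishes,
and otherwise both residuals are nonpositive. Multipliers are negatives of these coefficients. -/
theorem compResidual_sign (a b : ℝ) :
    (compResidualLeft a b ≤ 0 ∧ compResidualRight a b ≤ 0) ∨
      compResidualLeft a b * compResidualRight a b = 0 := by
  unfold compResidualLeft compResidualRight
  split_ifs with h
  · rcases le_total a 0 with ha | ha
    · exact Or.inl ⟨min_le_right _ _, h.trans ha⟩
    · right; simp [ha]
  · rcases le_total b 0 with hb | hb
    · exact Or.inl ⟨(not_le.1 h).le.trans hb, min_le_right _ _⟩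
    · right; simp [hb]

theorem compResidual_eq_zero_of_comp {a b : ℝ} (ha : 0 ≤ a) (hb : 0 ≤ b) (hab : a * b = 0) :
    compResidualLeft a b = 0 ∧ compResidualRight a b = 0 := by
  unfold compResidualLeft compResidualRight
  rcases mul_eq_zero.1 hab with rfl | rfl <;> split_ifs with h <;> simp_all
  exact le_antisymm h hb

theorem comp_of_compResidual_eq_zero {a b : ℝ} (h1 : compResidualLeft a b = 0)
    (h2 : compResidualRight a b = 0) : 0 ≤ a ∧ 0 ≤ b ∧ a * b = 0 := by
  simpa [h1, h2] using compResidual_projection a b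

theorem compResidualRight_eq_zero_of_lt {a b : ℝ} (hb : 0 < b) (hab : a < b) :
    compResidualRight a b = 0 := by
  simp [compResidualRight, not_le.2 hab, hb.le]

theorem compResidualLeft_eq_zero_of_lt {a b : ℝ} (ha : 0 < a) (hab : b < a) :
    compResidualLeft a b = 0 := by
  simp [compResidualLeft, hab.le, ha.le]

end Residuals

/-! ### Sign-preserving reduction of linear combinations. -/

section LinearAlgebra

theorem exists_subset_linearIndepOn_span_eq {σ E : Type*} [AddCommGroup E] [Module ℝ E]
    (w : σ → E) (M : Set σ) :
    ∃ B ⊆ M, LinearIndepOn ℝ w B ∧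
      Submodule.span ℝ (w '' B) = Submodule.span ℝ (w '' M) := by
  obtain ⟨B, hBM, -, hsp, hB⟩ := exists_linearIndepOn_extension
    (linearIndepOn_empty ℝ w) (Set.empty_subset M)
  exact ⟨B, hBM, hB, le_antisymm (Submodule.span_mono (Set.image_mono hBM))
    (Submodule.span_le.2 hsp)⟩

variable {σ E : Type*} [Fintype σ] [AddCommGroup E] [Module ℝ E]

theorem exists_relation_of_not_linearIndepOn {w : σ → E} {T : Set σ}
    (h : ¬ LinearIndepOn ℝ w T) :
    ∃ d : σ → ℝ, (∀ i ∉ T, d i = 0) ∧ ∑ i, d i • w i = 0 ∧ d ≠ 0 := by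
  classical
  have : Fintype T := Fintype.ofFinite T
  rw [LinearIndepOn, Fintype.not_linearIndependent_iff] at h
  obtain ⟨e, he, i, hi⟩ := h
  refine ⟨fun j => if hj : j ∈ T then e ⟨j, hj⟩ else 0, fun j hj => by simp [hj], ?_, fun h0 => ?_⟩
  · rw [← he, ← Finset.sum_subset (Finset.subset_univ (Finset.univ.map
      (Function.Embedding.subtype (· ∈ T))))]
    · simp
    · intro j _ hj
      have : j ∉ T := by simpa using hj
      simp [this]
  · exact hi (by simpa using congrFun h0 i)

theorem eq_zero_of_sum_smul_eq_zero {w : σ → E} {B : Set σ}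
    (hB : LinearIndepOn ℝ w B) {d : σ → ℝ} (hd : ∀ i ∉ B, d i = 0) (h0 : ∑ i, d i • w i = 0) :
    d = 0 := by
  classical
  have : Fintype B := Fintype.ofFinite B
  have h1 := Fintype.linearIndependent_iff.1 hB (fun i => d i) (by
    rw [← h0, ← Finset.sum_subset (Finset.subset_univ (Finset.univ.map
      (Function.Embedding.subtype (· ∈ B))))]
    · simp
    · intro j _ hj
      have : j ∉ B := by simpa using hj
      simp [hd j this])
  funext i
  by_cases hi : i ∈ B
  · exact h1 ⟨i, hi⟩
  · exact hd i hi

/-- Carathéodory's lemma relative to an independent subfamily: a linear combination can be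
rewritten with an independent support, keeping the signs of the remaining coefficients. -/
theorem exists_linearIndepOn_union_support {w : σ → E} {B : Set σ}
    (hB : LinearIndepOn ℝ w B) (c : σ → ℝ) :
    ∃ c' : σ → ℝ, ∑ i, c' i • w i = ∑ i, c i • w i ∧
      (∀ i ∉ B, c' i = 0 ∨ 0 < c' i * c i) ∧ LinearIndepOn ℝ w (B ∪ Function.support c') := by
  classical
  induction hn : (Finset.univ.filter fun i => i ∉ B ∧ c i ≠ 0).card using Nat.strong_induction_on
    generalizing c with
  | _ n ih =>
  by_cases hind : LinearIndepOn ℝ w (B ∪ Function.support c)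
  · refine ⟨c, rfl, fun i _ => ?_, hind⟩
    by_cases hi : c i = 0
    · exact Or.inl hi
    · exact Or.inr (mul_self_pos.2 hi)
  obtain ⟨d, hd, hd0, hdne⟩ := exists_relation_of_not_linearIndepOn hind
  -- A relation supported in `B` alone would be trivial, so some coefficient outside `B` can be
  -- eliminated.
  have hne : (Finset.univ.filter fun i => i ∉ B ∧ d i ≠ 0).Nonempty := by
    by_contra hcon
    refine hdne (eq_zero_of_sum_smul_eq_zero hB (fun i hi => ?_) hd0)
    by_contra hdi
    exact hcon ⟨i, by simp [hi, hdi]⟩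
  -- The smallest ratio in absolute value makes c - t d vanish at `j` while no other coefficient
  -- outside `B` changes sign.
  obtain ⟨j, hj, hjmin⟩ := Finset.exists_min_image _ (fun i => |c i / d i|) hne
  simp only [Finset.mem_filter, Finset.mem_univ, true_and] at hj hjmin
  set t := c j / d j
  have hsign : ∀ i ∉ B, c i - t * d i = 0 ∨ 0 < (c i - t * d i) * c i := by
    intro i hi
    by_cases hdi : d i = 0
    · simp only [hdi, mul_zero, sub_zero]
      by_cases hci : c i = 0
      exacts [Or.inl hci, Or.inr (mul_self_pos.2 hci)]
    · have h1 := hjmin i ⟨hi, hdi⟩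
      rw [abs_div (c i), le_div_iff₀ (abs_pos.2 hdi), ← abs_mul] at h1
      by_cases h0 : c i - t * d i = 0
      · exact Or.inl h0
      · right
        have h2 : t * d i * c i ≤ c i * c i := by
          calc t * d i * c i ≤ |t * d i * c i| := le_abs_self _
            _ = |t * d i| * |c i| := abs_mul _ _
            _ ≤ |c i| * |c i| := mul_le_mul_of_nonneg_right h1 (abs_nonneg _)
            _ = c i * c i := abs_mul_abs_self _
        refine lt_of_le_of_ne (by linarith) fun h3 => ?_
        rcases mul_eq_zero.1 h3.symm with h4 | h4
        · exact h0 h4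
        · rw [h4, abs_zero] at h1
          have := abs_eq_zero.1 (le_antisymm h1 (abs_nonneg _))
          exact h0 (by linarith)
  have hcard : (Finset.univ.filter fun i => i ∉ B ∧ c i - t * d i ≠ 0).card < n := by
    rw [← hn]
    refine Finset.card_lt_card ((Finset.ssubset_iff_of_subset fun i => ?_).2 ⟨j, ?_, ?_⟩)
    · simp only [Finset.mem_filter, Finset.mem_univ, true_and]
      rintro ⟨hi, hi'⟩
      refine ⟨hi, fun h0 => ?_⟩
      have := hsign i hi
      simp_all
    · simp only [Finset.mem_filter, Finset.mem_univ, true_and]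
      refine ⟨hj.1, fun h0 => hj.2 (hd j ?_)⟩
      simp [hj.1, h0]
    · simp [t, hj.2]
  obtain ⟨c', hc', hs', hi'⟩ := ih _ hcard (fun i => c i - t * d i) rfl
  refine ⟨c', ?_, fun i hi => ?_, hi'⟩
  · rw [hc']
    simp only [sub_smul, Finset.sum_sub_distrib, mul_smul, ← Finset.smul_sum, hd0, smul_zero,
      sub_zero]
  · rcases hs' i hi with h | h
    · exact Or.inl h
    · right
      rcases hsign i hi with h1 | h1
      · rw [h1, mul_zero] at h; exact absurd h (lt_irrefl _)
      · have h2 : 0 < (c' i * c i) * ((c i - t * d i) * (c i - t * d i)) := by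
          have := mul_pos h h1
          nlinarith
        exact pos_of_mul_pos_left h2 (mul_self_nonneg _)

theorem exists_eq_sum_smul_of_mem_span_image {w : σ → E} {B : Set σ} {x : E}
    (hx : x ∈ Submodule.span ℝ (w '' B)) :
    ∃ b : σ → ℝ, (∀ i ∉ B, b i = 0) ∧ ∑ i, b i • w i = x := by
  classical
  obtain ⟨l, hl, rfl⟩ := (Finsupp.mem_span_image_iff_linearCombination ℝ).1 hx
  refine ⟨l, fun i hi => ?_, ?_⟩
  · by_contra h
    exact hi (hl (Finsupp.mem_support_iff.2 h))
  · rw [Finsupp.linearCombination_apply, Finsupp.sum_fintype _ _ (by simp)]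

/-- Reduction of a linear combination over a family in which the members indexed by `M` are
generated by the independent members indexed by `B ⊆ M`. -/
theorem exists_reduced_combination {w : σ → E} {B M : Set σ} (hBM : B ⊆ M)
    (hB : LinearIndepOn ℝ w B)
    (hspan : Submodule.span ℝ (w '' B) = Submodule.span ℝ (w '' M)) (c : σ → ℝ) :
    ∃ c' : σ → ℝ, ∑ i, c' i • w i = ∑ i, c i • w i ∧ (∀ i ∈ M, i ∉ B → c' i = 0) ∧
      (∀ i ∉ M, c' i = 0 ∨ 0 < c' i * c i) ∧ LinearIndepOn ℝ w (B ∪ Function.support c') := by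
  classical
  have hmem : ∑ i, (if i ∈ M then c i else 0) • w i ∈ Submodule.span ℝ (w '' B) := by
    rw [hspan]
    refine Submodule.sum_mem _ fun i _ => ?_
    split_ifs with h
    · exact Submodule.smul_mem _ _ (Submodule.subset_span ⟨i, h, rfl⟩)
    · simp
  obtain ⟨b, hb, hsum⟩ := exists_eq_sum_smul_of_mem_span_image hmem
  obtain ⟨c', h1, h2, h3⟩ := exists_linearIndepOn_union_support hB
    fun i => if i ∈ M then b i else c i
  refine ⟨c', ?_, fun i hi hiB => ?_, fun i hi => ?_, h3⟩
  · have h4 : ∑ i, b i • w i = ∑ i, (if i ∈ M then b i else 0) • w i :=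
      Finset.sum_congr rfl fun i _ => by
        split_ifs with h
        · rfl
        · rw [hb i fun hB => h (hBM hB)]
    rw [h1, ← sub_eq_zero]
    rw [h4, ← sub_eq_zero] at hsum
    rw [← hsum, ← Finset.sum_sub_distrib, ← Finset.sum_sub_distrib]
    refine Finset.sum_congr rfl fun i _ => ?_
    split_ifs <;> simp
  · have := h2 i hiB
    simpa [hi, hb i hiB] using this
  · simpa [hi] using h2 i fun h => hi (hBM h)

end LinearAlgebra

/-! ### Persistence of a basis under constant rank. -/

section ConstantRank

variable {X σ E : Type*} [TopologicalSpace X] [Finite σ] [NormedAddCommGroup E] [NormedSpace ℝ E]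

/-- A basis of the span of a continuous family of locally constant rank stays a basis nearby. -/
theorem eventually_linearIndepOn_and_span_eq {w : X → σ → E} {x : X} {B M : Set σ} (hBM : B ⊆ M)
    (hw : ∀ i, ContinuousAt (fun y => w y i) x) (hB : LinearIndepOn ℝ (w x) B)
    (hspan : Submodule.span ℝ (w x '' B) = Submodule.span ℝ (w x '' M))
    (hrank : ∀ᶠ y in 𝓝 x, Module.finrank ℝ (Submodule.span ℝ (w y '' M)) =
      Module.finrank ℝ (Submodule.span ℝ (w x '' M))) :
    ∀ᶠ y in 𝓝 x, LinearIndepOn ℝ (w y) B ∧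
      Submodule.span ℝ (w y '' B) = Submodule.span ℝ (w y '' M) := by
  have hfin : ∀ y, LinearIndepOn ℝ (w y) B →
      Module.finrank ℝ (Submodule.span ℝ (w y '' B)) = Nat.card B := by
    intro y hy
    have : Fintype B := Fintype.ofFinite B
    rw [← Set.range_domRestrict, Nat.card_eq_fintype_card]
    exact finrank_span_eq_card hy
  have hc : ContinuousAt (fun y (i : B) => w y i) x := continuousAt_pi.2 fun i => hw i
  filter_upwards [hrank, hc.eventually (isOpen_setOfPred_linearIndependent.mem_nhds hB)] with y hy hyB
  refine ⟨hyB, ?_⟩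
  have : FiniteDimensional ℝ (Submodule.span ℝ (w y '' M)) :=
    FiniteDimensional.span_of_finite ℝ (Set.toFinite _)
  -- Independence is an open condition, so both spans have dimension card B near `x`, and one
  -- contains the other.
  refine Submodule.eq_of_le_of_finrank_eq (Submodule.span_mono (Set.image_mono hBM)) ?_
  rw [hy, ← hspan, hfin x hB]
  exact hfin y hyB

end ConstantRank

/-! ### Residuals of a constraint system and approximate multipliers. -/

namespace FeasSystem

variable {E ι κ π : Type*}

/-- `x` satisfies all constraints of the system. -/
def IsFeasible (S : FeasSystem E ι κ π) (x : E) : Prop :=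
  (∀ i, S.g i x ≤ 0) ∧ (∀ i, S.h i x = 0) ∧
    ∀ i, 0 ≤ S.G i x ∧ 0 ≤ S.H i x ∧ S.G i x * S.H i x = 0

/-- All constraint functions of the system as one family. -/
def constraints (S : FeasSystem E ι κ π) : ι ⊕ κ ⊕ π ⊕ π → E → ℝ :=
  Sum.elim S.g (Sum.elim S.h (Sum.elim S.G S.H))

/-- Residual of a vector of constraint values with respect to the set of admissible values. -/
noncomputable def residual (t : ι ⊕ κ ⊕ π ⊕ π → ℝ) : ι ⊕ κ ⊕ π ⊕ π → ℝ :=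
  Sum.elim (fun i => max (t (.inl i)) 0) (Sum.elim (fun i => t (.inr (.inl i)))
    (Sum.elim (fun i => compResidualLeft (t (.inr (.inr (.inl i)))) (t (.inr (.inr (.inr i)))))
      (fun i => compResidualRight (t (.inr (.inr (.inl i)))) (t (.inr (.inr (.inr i)))))))

/-- The sign conditions on M-multipliers, for the coefficients `(lg, lh, -lG, -lH)`, in a form
that is visibly closed. -/
structure MultiplierCone (S : FeasSystem E ι κ π) (x : E) (c : ι ⊕ κ ⊕ π ⊕ π → ℝ) : Prop where
  nonneg : ∀ i, 0 ≤ c (.inl i)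
  inactive : ∀ i, i ∉ S.activeSet x → c (.inl i) = 0
  setI : ∀ i ∈ S.setI x, c (.inr (.inr (.inr i))) = 0
  setK : ∀ i ∈ S.setK x, c (.inr (.inr (.inl i))) = 0
  setJ : ∀ i ∈ S.setJ x, (c (.inr (.inr (.inl i))) ≤ 0 ∧ c (.inr (.inr (.inr i))) ≤ 0) ∨
    c (.inr (.inr (.inl i))) * c (.inr (.inr (.inr i))) = 0

theorem MultiplierCone.smul {S : FeasSystem E ι κ π} {x : E} {c : ι ⊕ κ ⊕ π ⊕ π → ℝ}
    (h : S.MultiplierCone x c) {t : ℝ} (ht : 0 ≤ t) : S.MultiplierCone x (t • c) where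
  nonneg i := mul_nonneg ht (h.nonneg i)
  inactive i hi := by simp [h.inactive i hi]
  setI i hi := by simp [h.setI i hi]
  setK i hi := by simp [h.setK i hi]
  setJ i hi := by
    rcases h.setJ i hi with ⟨h1, h2⟩ | h1
    · exact Or.inl ⟨mul_nonpos_of_nonneg_of_nonpos ht h1, mul_nonpos_of_nonneg_of_nonpos ht h2⟩
    · right
      simp only [Pi.smul_apply, smul_eq_mul]
      linear_combination t ^ 2 * h1

/-- The weak inequalities in the biactive alternative lose nothing compared with strict ones,
because a zero entry makes the product vanish. Closedness lets the signs survive limits. -/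
theorem isClosed_multiplierCone (S : FeasSystem E ι κ π) (x : E) :
    IsClosed {c | S.MultiplierCone x c} := by
  have h : {c | S.MultiplierCone x c} = {c | (∀ i, 0 ≤ c (.inl i)) ∧
      (∀ i, i ∉ S.activeSet x → c (.inl i) = 0) ∧
      (∀ i ∈ S.setI x, c (.inr (.inr (.inr i))) = 0) ∧
      (∀ i ∈ S.setK x, c (.inr (.inr (.inl i))) = 0) ∧
      ∀ i ∈ S.setJ x, (c (.inr (.inr (.inl i))) ≤ 0 ∧ c (.inr (.inr (.inr i))) ≤ 0) ∨
        c (.inr (.inr (.inl i))) * c (.inr (.inr (.inr i))) = 0} :=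
    Set.ext fun c => ⟨fun h => ⟨h.1, h.2, h.3, h.4, h.5⟩, fun h =>
      ⟨h.1, h.2.1, h.2.2.1, h.2.2.2.1, h.2.2.2.2⟩⟩
  rw [h]
  simp only [Set.ofPred_and, Set.ofPred_forall, Set.ofPred_or]
  refine IsClosed.inter (isClosed_iInter fun i => ?_) (IsClosed.inter (isClosed_iInter fun i =>
    isClosed_iInter fun _ => ?_) (IsClosed.inter (isClosed_iInter fun i => isClosed_iInter fun _ => ?_)
    (IsClosed.inter (isClosed_iInter fun i => isClosed_iInter fun _ => ?_)
    (isClosed_iInter fun i => isClosed_iInter fun _ => IsClosed.union (IsClosed.inter ?_ ?_) ?_))))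
  · exact isClosed_le (by fun_prop) (by fun_prop)
  · exact isClosed_eq (by fun_prop) (by fun_prop)
  · exact isClosed_eq (by fun_prop) (by fun_prop)
  · exact isClosed_eq (by fun_prop) (by fun_prop)
  · exact isClosed_le (by fun_prop) (by fun_prop)
  · exact isClosed_le (by fun_prop) (by fun_prop)
  · exact isClosed_eq (by fun_prop) (by fun_prop)

/-- Reducing coefficients while keeping signs outside the gradients of fixed status preserves
the sign conditions. -/
theorem MultiplierCone.of_sign {S : FeasSystem E ι κ π} {x : E} {c c' : ι ⊕ κ ⊕ π ⊕ π → ℝ}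
    (h : S.MultiplierCone x c)
    (hc : ∀ j, j ∉ Sum.inr '' gradIndices Set.univ (S.setI x) (S.setK x) →
      c' j = 0 ∨ 0 < c' j * c j) : S.MultiplierCone x c' := by
  have hg : ∀ i, c' (.inl i) = 0 ∨ 0 < c' (.inl i) * c (.inl i) := fun i =>
    hc _ (by simp)
  have hGG : ∀ i, i ∉ S.setI x → c' (.inr (.inr (.inl i))) = 0 ∨
      0 < c' (.inr (.inr (.inl i))) * c (.inr (.inr (.inl i))) := fun i hi =>
    hc _ (by simpa [gradIndices] using hi)
  have hHH : ∀ i, i ∉ S.setK x → c' (.inr (.inr (.inr i))) = 0 ∨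
      0 < c' (.inr (.inr (.inr i))) * c (.inr (.inr (.inr i))) := fun i hi =>
    hc _ (by simpa [gradIndices] using hi)
  have hnp : ∀ a b : ℝ, (a = 0 ∨ 0 < a * b) → b ≤ 0 → a ≤ 0 := by
    rintro a b (h | h) hb
    · exact h.le
    · by_contra ha
      nlinarith
  refine ⟨fun i => ?_, fun i hi => ?_, fun i hi => ?_, fun i hi => ?_, fun i hi => ?_⟩
  · rcases hg i with h1 | h1
    · exact h1.ge
    · by_contra h2
      nlinarith [h.nonneg i]
  · simpa [h.inactive i hi] using hg i
  · simpa [h.setI i hi] using hHH i fun h' => (hi.1 ▸ h'.1).false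
  · simpa [h.setK i hi] using hGG i fun h' => (h'.1 ▸ hi.1).false
  · have h1 := hGG i fun h' => (hi.2 ▸ h'.2).false
    have h2 := hHH i fun h' => (hi.1 ▸ h'.1).false
    rcases h.setJ i hi with ⟨h3, h4⟩ | h3
    · exact Or.inl ⟨hnp _ _ h1 h3, hnp _ _ h2 h4⟩
    · right
      rcases mul_eq_zero.1 h3 with h3 | h3
      · simp_all
      · simp_all

section Residual

variable [Fintype ι] [Fintype κ] [Fintype π]

theorem continuous_sum_residual_sq :
    Continuous fun t : ι ⊕ κ ⊕ π ⊕ π → ℝ => ∑ j, residual t j ^ 2 := by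
  simp only [Fintype.sum_sum_type, residual, Sum.elim_inl, Sum.elim_inr,
    ← Finset.sum_add_distrib, compResidual_sq_add_sq]
  fun_prop

/-- The point `t - residual t` is admissible and the left side is the squared distance from `t'` to
the admissible set. This is the quadratic upper model used by `isLocalMin_linearized`. -/
theorem sum_residual_sq_le (t t' : ι ⊕ κ ⊕ π ⊕ π → ℝ) :
    ∑ j, residual t' j ^ 2 ≤ ∑ j, (t' j - t j + residual t j) ^ 2 := by
  simp only [Fintype.sum_sum_type, residual, Sum.elim_inl, Sum.elim_inr,
    ← Finset.sum_add_distrib]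
  refine add_le_add (Finset.sum_le_sum fun i _ => ?_) (add_le_add (Finset.sum_le_sum fun i _ => ?_)
    (Finset.sum_le_sum fun i _ => ?_))
  · rcases le_total (t (.inl i)) 0 with h | h <;> rcases le_total (t' (.inl i)) 0 with h' | h' <;>
      simp only [h, h', max_eq_left, max_eq_right] <;> nlinarith
  · simp
  · obtain ⟨h1, h2, h3⟩ := compResidual_projection (t (.inr (.inr (.inl i))))
      (t (.inr (.inr (.inr i))))
    have := compResidual_sq_add_sq_le (a := t' (.inr (.inr (.inl i))))
      (b := t' (.inr (.inr (.inr i)))) h1 h2 h3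
    exact this.trans_eq (by ring)

end Residual

theorem residual_constraints_eq_zero_iff (S : FeasSystem E ι κ π) (y : E) :
    residual (fun j => S.constraints j y) = 0 ↔ S.IsFeasible y := by
  constructor
  · intro h
    refine ⟨fun i => ?_, fun i => ?_, fun i => ?_⟩
    · have := congrFun h (.inl i)
      simpa [residual, constraints] using this
    · exact congrFun h (.inr (.inl i))
    · exact comp_of_compResidual_eq_zero (congrFun h (.inr (.inr (.inl i))))
        (congrFun h (.inr (.inr (.inr i))))
  · rintro ⟨h1, h2, h3⟩
    funext j
    rcases j with i | i | i | i
    · simpa [residual, constraints] using h1 i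
    · exact h2 i
    · exact (compResidual_eq_zero_of_comp (h3 i).1 (h3 i).2.1 (h3 i).2.2).1
    · exact (compResidual_eq_zero_of_comp (h3 i).1 (h3 i).2.1 (h3 i).2.2).2

/-- Strict inequalities at `x` persist nearby, so inactive constraints have no residual and each
nondegenerate pair projects onto the branch it occupies at `x`. Biactive pairs use
`compResidual_sign`. -/
theorem eventually_multiplierCone_residual [TopologicalSpace E] [Finite ι] [Finite π]
    {S : FeasSystem E ι κ π} {x : E} (hx : S.IsFeasible x)
    (hc : ∀ j, ContinuousAt (S.constraints j) x) :
    ∀ᶠ y in 𝓝 x, S.MultiplierCone x (residual fun j => S.constraints j y) := by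
  have h1 : ∀ᶠ y in 𝓝 x, ∀ i, i ∉ S.activeSet x → S.g i y < 0 := by
    refine eventually_all.2 fun i => eventually_imp_distrib_left.2 fun hi => ?_
    exact (hc (.inl i)).eventually (gt_mem_nhds (lt_of_le_of_ne (hx.1 i) hi))
  have h2 : ∀ᶠ y in 𝓝 x, ∀ i, i ∈ S.setI x → 0 < S.H i y ∧ S.G i y < S.H i y := by
    refine eventually_all.2 fun i => eventually_imp_distrib_left.2 fun hi => ?_
    have hH : ContinuousAt (S.H i) x := hc (.inr (.inr (.inr i)))
    have hG : ContinuousAt (S.G i) x := hc (.inr (.inr (.inl i)))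
    exact (hH.eventually (lt_mem_nhds hi.2)).and (hG.eventually_lt hH (by rw [hi.1]; exact hi.2))
  have h3 : ∀ᶠ y in 𝓝 x, ∀ i, i ∈ S.setK x → 0 < S.G i y ∧ S.H i y < S.G i y := by
    refine eventually_all.2 fun i => eventually_imp_distrib_left.2 fun hi => ?_
    have hH : ContinuousAt (S.H i) x := hc (.inr (.inr (.inr i)))
    have hG : ContinuousAt (S.G i) x := hc (.inr (.inr (.inl i)))
    exact (hG.eventually (lt_mem_nhds hi.1)).and (hH.eventually_lt hG (by rw [hi.2]; exact hi.1))
  filter_upwards [h1, h2, h3] with y h1 h2 h3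
  refine ⟨fun i => le_max_right _ _, fun i hi => max_eq_right (h1 i hi).le, fun i hi =>
    compResidualRight_eq_zero_of_lt (h2 i hi).1 (h2 i hi).2, fun i hi =>
    compResidualLeft_eq_zero_of_lt (h3 i hi).1 (h3 i hi).2, fun i _ => compResidual_sign _ _⟩

variable [NormedAddCommGroup E] [InnerProductSpace ℝ E] [FiniteDimensional ℝ E] [CompleteSpace E]
  [Fintype ι] [Fintype κ] [Fintype π]

/-- Approximate M-stationarity of local solutions: multipliers at nearby points, vanishing
if the nearby point is the solution itself. -/
theorem exists_approximate_multipliers {S : FeasSystem E ι κ π} {φ : E → ℝ} {x : E}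
    (hφ : LipschitzNear φ x) (hg : ∀ i, LipschitzNear (S.g i) x) (hh : ∀ i, ContDiff ℝ 1 (S.h i))
    (hG : ∀ i, ContDiff ℝ 1 (S.G i)) (hH : ∀ i, ContDiff ℝ 1 (S.H i)) (hx : S.IsFeasible x)
    (hmin : ∀ᶠ y in 𝓝 x, S.IsFeasible y → φ x ≤ φ y) :
    ∃ (z ξ : ℕ → E) (v : ℕ → ι → E) (c : ℕ → ι ⊕ κ ⊕ π ⊕ π → ℝ),
      Tendsto z atTop (𝓝 x) ∧ ∀ k, ξ k ∈ limitingSubdiff φ (z k) ∧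
        (∀ i, v k i ∈ limitingSubdiff (S.g i) (z k)) ∧ S.MultiplierCone x (c k) ∧
        ξ k + ∑ j, c k j • Sum.elim (v k) (S.smoothGrads (z k)) j + (z k - x) = 0 ∧
        (z k = x → c k = 0) := by
  have hlip : ∀ j, LipschitzNear (S.constraints j) x := by
    rintro (i | i | i | i)
    exacts [hg i, (hh i).locallyLipschitz.lipschitzNear x, (hG i).locallyLipschitz.lipschitzNear x,
      (hH i).locallyLipschitz.lipschitzNear x]
  have hlip' : ∀ᶠ y in 𝓝 x, ∀ j, LipschitzNear (S.constraints j) y :=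
    eventually_all.2 fun j => (hlip j).eventually
  let ρ : E → ℝ := fun y => 1 / 2 * ∑ j, residual (fun j => S.constraints j y) j ^ 2
  have hρ0 : ∀ y, ρ y = 0 ↔ S.IsFeasible y := by
    intro y
    rw [← residual_constraints_eq_zero_iff, funext_iff]
    simp only [ρ, mul_eq_zero, one_div, inv_eq_zero, OfNat.ofNat_ne_zero, false_or]
    rw [Finset.sum_eq_zero_iff_of_nonneg fun _ _ => sq_nonneg _]
    simp
  obtain ⟨z, hz, hzmin⟩ := exists_tendsto_isLocalMin_penalized (φ := φ) (ρ := ρ) (x := x)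
    (hφ.eventually.mono fun y hy => hy.continuousAt)
    (hlip'.mono fun y hy => by
      have h1 : ContinuousAt (fun y j => S.constraints j y) y :=
        continuousAt_pi.2 fun j => (hy j).continuousAt
      exact continuousAt_const.mul (ContinuousAt.comp
        (g := fun t : ι ⊕ κ ⊕ π ⊕ π → ℝ => ∑ j, residual t j ^ 2)
        continuous_sum_residual_sq.continuousAt h1))
    (fun y => by positivity) ((hρ0 x).2 hx) (hmin.mono fun y hy h => hy ((hρ0 y).1 h))
  have hev : ∀ᶠ k in atTop, ∃ (ξ : E) (v : ι → E) (c : ι ⊕ κ ⊕ π ⊕ π → ℝ),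
      ξ ∈ limitingSubdiff φ (z k) ∧ (∀ i, v i ∈ limitingSubdiff (S.g i) (z k)) ∧
        S.MultiplierCone x c ∧
        ξ + ∑ j, c j • Sum.elim v (S.smoothGrads (z k)) j + (z k - x) = 0 ∧
        (z k = x → c = 0) := by
    filter_upwards [hzmin, hz.eventually hφ.eventually, hz.eventually hlip',
      hz.eventually (eventually_multiplierCone_residual hx fun j => (hlip j).continuousAt)]
      with k hk hφk hlk hcone
    obtain ⟨C, hC⟩ := isLocalMin_linearized (Nat.cast_nonneg k) sum_residual_sq_le hlk hk
    obtain ⟨ξ, hξ, ω, hω, hsum⟩ := exists_limitingSubdiff_of_isLocalMin hφk hlk hC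
    set c : ι ⊕ κ ⊕ π ⊕ π → ℝ := fun j => (k : ℝ) * residual (fun j => S.constraints j (z k)) j
    have hcc : S.MultiplierCone x c := hcone.smul (Nat.cast_nonneg k)
    -- Only the nonsmooth inequalities need nonnegative weights here; the remaining functions are
    -- C¹, so their weights may have any sign.
    choose v hv hωv using fun i => exists_eq_smul_of_mem_limitingSubdiff (hcc.nonneg i)
      (hlk (.inl i)) (hω (.inl i))
    refine ⟨ξ, v, c, hξ, hv, hcc, ?_, fun h0 => ?_⟩
    · rw [← hsum]
      congr 2
      refine Finset.sum_congr rfl fun j _ => ?_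
      rcases j with i | i | i | i
      · exact (hωv i).symm
      · exact (eq_smul_gradient_of_mem_limitingSubdiff (hh i) (hω (.inr (.inl i)))).symm
      · exact (eq_smul_gradient_of_mem_limitingSubdiff (hG i) (hω (.inr (.inr (.inl i))))).symm
      · exact (eq_smul_gradient_of_mem_limitingSubdiff (hH i) (hω (.inr (.inr (.inr i))))).symm
    · have := (residual_constraints_eq_zero_iff S x).2 hx
      funext j
      simp [c, h0, this]
  obtain ⟨N, hN⟩ := eventually_atTop.1 hev
  choose ξ v c h using fun k => hN (k + N) (by lia)
  exact ⟨fun k => z (k + N), ξ, v, c, (tendsto_add_atTop_iff_nat N).2 hz, h⟩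

end FeasSystem

/-! ### From RCPLD to M-stationarity. -/

namespace FeasSystem

variable {E ι κ π : Type*} [NormedAddCommGroup E] [InnerProductSpace ℝ E]
  [CompleteSpace E]

theorem continuous_smoothGrads {S : FeasSystem E ι κ π} (hh : ∀ i, ContDiff ℝ 1 (S.h i))
    (hG : ∀ i, ContDiff ℝ 1 (S.G i)) (hH : ∀ i, ContDiff ℝ 1 (S.H i)) (j : κ ⊕ π ⊕ π) :
    Continuous fun y => S.smoothGrads y j := by
  rcases j with i | i | i
  exacts [(hh i).continuous_gradient, (hG i).continuous_gradient, (hH i).continuous_gradient]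

variable [Fintype ι] [Fintype κ] [Fintype π]

theorem MultiplierCone.mStationary {S : FeasSystem E ι κ π} {φ : E → ℝ} {x ξ : E} {v : ι → E}
    {c : ι ⊕ κ ⊕ π ⊕ π → ℝ} (hc : S.MultiplierCone x c) (hξ : ξ ∈ limitingSubdiff φ x)
    (hv : ∀ i, v i ∈ limitingSubdiff (S.g i) x)
    (h0 : ξ + ∑ j, c j • Sum.elim v (S.smoothGrads x) j = 0) : S.MStationary φ x := by
  refine ⟨ξ, v, fun i => c (.inl i), fun i => c (.inr (.inl i)),
    fun i => -c (.inr (.inr (.inl i))), fun i => -c (.inr (.inr (.inr i))), hξ, fun i _ => hv i,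
    fun i _ => hc.nonneg i, hc.inactive, ?_, fun i hi => ?_, fun i hi => ?_, fun i hi => ?_⟩
  · rw [← h0]
    simp only [Fintype.sum_sum_type, smoothGrads, Sum.elim_inl, Sum.elim_inr, neg_smul,
      Finset.sum_neg_distrib]
    abel
  · simp [hc.setI i hi]
  · simp [hc.setK i hi]
  · rcases hc.setJ i hi with ⟨h1, h2⟩ | h1
    · rcases h1.eq_or_lt with h1 | h1
      · right; simp [h1]
      · rcases h2.eq_or_lt with h2 | h2
        · right; simp [h2]
        · exact Or.inl ⟨neg_pos.2 h1, neg_pos.2 h2⟩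
    · right; simpa using h1

/-- RCPLD excludes nontrivial singular multipliers supported on a family of (sub)gradients that
stays linearly independent along a sequence. -/
theorem RCPLD.eq_zero_of_linearIndepOn {S : FeasSystem E ι κ π} {x : E} (hR : S.RCPLD x)
    (hx : S.IsFeasible x) {B : Set (κ ⊕ π ⊕ π)} {T : Set (ι ⊕ κ ⊕ π ⊕ π)}
    (hBM : B ⊆ gradIndices Set.univ (S.setI x) (S.setK x))
    (hB : LinearIndepOn ℝ (S.smoothGrads x) B)
    (hspan : Submodule.span ℝ (S.smoothGrads x '' B) = Submodule.span ℝ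
      (S.smoothGrads x '' gradIndices Set.univ (S.setI x) (S.setK x)))
    {c : ι ⊕ κ ⊕ π ⊕ π → ℝ} {v : ι → E} {z : ℕ → E} {vk : ℕ → ι → E}
    (hc : S.MultiplierCone x c) (hcT : ∀ j ∉ T, c j = 0)
    (hcB : ∀ j ∈ gradIndices Set.univ (S.setI x) (S.setK x), j ∉ B → c (.inr j) = 0)
    (hTa : ∀ i, Sum.inl i ∈ T → i ∈ S.activeSet x)
    (hv : ∀ i, v i ∈ limitingSubdiff (S.g i) x)
    (h0 : ∑ j, c j • Sum.elim v (S.smoothGrads x) j = 0) (hzx : ∀ k, z k ≠ x)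
    (hz : Tendsto z atTop (𝓝 x)) (hvk : ∀ k i, vk k i ∈ limitingSubdiff (S.g i) (z k))
    (hvlim : ∀ i, Tendsto (fun k => vk k i) atTop (𝓝 (v i)))
    (hind : ∀ k, LinearIndepOn ℝ (Sum.elim (vk k) (S.smoothGrads (z k))) (Sum.inr '' B ∪ T)) :
    c = 0 := by
  by_contra hne
  let I₁ : Set κ := {i | .inl i ∈ B}
  let I₂ : Set π := {i | .inr (.inl i) ∈ B}
  let I₃ : Set π := {i | .inr (.inr i) ∈ B}
  have hBI : gradIndices I₁ I₂ I₃ = B := by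
    ext j
    rcases j with i | i | i <;> simp [gradIndices, I₁, I₂, I₃]
  have hI₂ : I₂ ⊆ S.setI x := fun i hi => by simpa [gradIndices] using hBM hi
  have hI₃ : I₃ ⊆ S.setK x := fun i hi => by simpa [gradIndices] using hBM hi
  -- Feasibility places `i` in one of `setI`, `setJ`, `setK`: the coefficient vanishes off `B` in
  -- the first case, off `T` in the second, and always in the third.
  have hcG : ∀ i, i ∉ I₂ ∪ {i | i ∈ S.setJ x ∧ Sum.inr (Sum.inr (Sum.inl i)) ∈ T} →
      c (.inr (.inr (.inl i))) = 0 := by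
    intro i hi
    by_contra hci
    have hiT : Sum.inr (Sum.inr (Sum.inl i)) ∈ T := by_contra fun h => hci (hcT _ h)
    obtain ⟨h1, h2, h3⟩ := hx.2.2 i
    rcases h1.eq_or_lt' with hG | hG
    · rcases h2.eq_or_lt' with hH | hH
      · exact hi (Or.inr ⟨⟨hG, hH⟩, hiT⟩)
      · exact hci (hcB _ (by have hI : i ∈ S.setI x := ⟨hG, hH⟩; simpa [gradIndices] using hI)
          fun h => hi (Or.inl h))
    · exact hci (hc.setK i ⟨hG, (mul_eq_zero.1 h3).resolve_left hG.ne'⟩)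
  have hcH : ∀ i, i ∉ I₃ ∪ {i | i ∈ S.setJ x ∧ Sum.inr (Sum.inr (Sum.inr i)) ∈ T} →
      c (.inr (.inr (.inr i))) = 0 := by
    intro i hi
    by_contra hci
    have hiT : Sum.inr (Sum.inr (Sum.inr i)) ∈ T := by_contra fun h => hci (hcT _ h)
    obtain ⟨h1, h2, h3⟩ := hx.2.2 i
    rcases h2.eq_or_lt' with hH | hH
    · rcases h1.eq_or_lt' with hG | hG
      · exact hi (Or.inr ⟨⟨hG, hH⟩, hiT⟩)
      · exact hci (hcB _ (by have hK : i ∈ S.setK x := ⟨hG, hH⟩; simpa [gradIndices] using hK)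
          fun h => hi (Or.inl h))
    · exact hci (hc.setI i ⟨(mul_eq_zero.1 h3).resolve_right hH.ne', hH⟩)
  have hev := hR.2 I₁ I₂ I₃ hI₂ hI₃ (by rwa [hBI]) (by rwa [hBI]) {i | Sum.inl i ∈ T}
    {i | i ∈ S.setJ x ∧ Sum.inr (Sum.inr (Sum.inl i)) ∈ T}
    {i | i ∈ S.setJ x ∧ Sum.inr (Sum.inr (Sum.inr i)) ∈ T} hTa
    (fun i hi => hi.1) (fun i hi => hi.1)
    (fun i => c (.inl i)) (fun i => c (.inr (.inl i))) (fun i => -c (.inr (.inr (.inl i))))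
    (fun i => -c (.inr (.inr (.inr i)))) v (fun i hi => hcT _ hi)
    (fun i hi => hcB _ (by simp [gradIndices]) hi) (fun i hi => by simpa using hcG i hi)
    (fun i hi => by simpa using hcH i hi) (fun h => hne ?_) (fun i _ => hc.nonneg i) (fun i hi => ?_)
    (fun i _ => hv i) ?_ z vk hzx (fun k i _ => hvk k i) hz fun i _ => hvlim i
  · obtain ⟨k, hk⟩ := hev.exists
    refine hk ((hind k).mono ?_)
    rintro j (⟨i, hi, rfl⟩ | ⟨j, hj, rfl⟩)
    · exact Or.inr hi
    · rcases j with i | i | i <;> simp only [gradIndices, Set.mem_union, Set.mem_image,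
        Function.comp_apply, Sum.inl.injEq, Sum.inr.injEq, reduceCtorEq, and_false, exists_false,
        exists_eq_right, or_false, false_or] at hj
      · exact Or.inl ⟨_, hj, rfl⟩
      · rcases hj with hj | hj
        exacts [Or.inl ⟨_, hj, rfl⟩, Or.inr hj.2]
      · rcases hj with hj | hj
        exacts [Or.inl ⟨_, hj, rfl⟩, Or.inr hj.2]
  · obtain ⟨h1, h2, h3, h4⟩ := h
    funext j
    rcases j with i | i | i | i
    exacts [congrFun h1 i, congrFun h2 i, neg_eq_zero.1 (congrFun h3 i),
      neg_eq_zero.1 (congrFun h4 i)]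
  · rcases hc.setJ i hi with ⟨h1, h2⟩ | h1
    · rcases h1.eq_or_lt with h1 | h1
      · right; simp [h1]
      · rcases h2.eq_or_lt with h2 | h2
        · right; simp [h2]
        · exact Or.inl ⟨neg_pos.2 h1, neg_pos.2 h2⟩
    · right; simpa using h1
  · rw [← h0]
    simp only [Fintype.sum_sum_type, smoothGrads, Sum.elim_inl, Sum.elim_inr, neg_smul,
      Finset.sum_neg_distrib]
    abel

/-- Local solutions satisfying RCPLD are M-stationary. -/
theorem RCPLD.mStationary [FiniteDimensional ℝ E] {S : FeasSystem E ι κ π} {φ : E → ℝ} {x : E}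
    (hR : S.RCPLD x)
    (hφ : LipschitzNear φ x) (hg : ∀ i, LipschitzNear (S.g i) x) (hh : ∀ i, ContDiff ℝ 1 (S.h i))
    (hG : ∀ i, ContDiff ℝ 1 (S.G i)) (hH : ∀ i, ContDiff ℝ 1 (S.H i)) (hx : S.IsFeasible x)
    (hmin : ∀ᶠ y in 𝓝 x, S.IsFeasible y → φ x ≤ φ y) : S.MStationary φ x := by
  obtain ⟨z, ξ, v, c, hz, happ⟩ := exists_approximate_multipliers hφ hg hh hG hH hx hmin
  -- RCPLD speaks only of sequences avoiding `x`. If some `z k` equals `x`, its multipliers vanish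
  -- and stationarity is immediate.
  by_cases hzx : ∃ k, z k = x
  · obtain ⟨k, hk⟩ := hzx
    obtain ⟨h1, h2, h3, h4, -⟩ := happ k
    rw [hk] at h1 h2 h4
    exact h3.mStationary h1 h2 (by simpa using h4)
  push Not at hzx
  set M := gradIndices (Set.univ : Set κ) (S.setI x) (S.setK x)
  obtain ⟨B, hBM, hB, hspan⟩ := exists_subset_linearIndepOn_span_eq (S.smoothGrads x) M
  have hnear := eventually_linearIndepOn_and_span_eq hBM
    (fun j => (continuous_smoothGrads hh hG hH j).continuousAt) hB hspan hR.1
  obtain ⟨K, hK⟩ := hφ.exists_norm_le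
  choose L hL using fun i => (hg i).exists_norm_le
  have hred : ∀ᶠ k in atTop, ∃ c' : ι ⊕ κ ⊕ π ⊕ π → ℝ, S.MultiplierCone x c' ∧
      ξ k + ∑ j, c' j • Sum.elim (v k) (S.smoothGrads (z k)) j + (z k - x) = 0 ∧
      (∀ j ∈ M, j ∉ B → c' (.inr j) = 0) ∧
      LinearIndepOn ℝ (Sum.elim (v k) (S.smoothGrads (z k)))
        (Sum.inr '' B ∪ Function.support c') ∧ ‖ξ k‖ ≤ K ∧ ∀ i, ‖v k i‖ ≤ L i := by
    filter_upwards [hz.eventually hnear, hz.eventually hK, hz.eventually (eventually_all.2 hL)]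
      with k hk hKk hLk
    obtain ⟨h1, h2, h3, h4, -⟩ := happ k
    have himg : ∀ A : Set (κ ⊕ π ⊕ π), Sum.elim (v k) (S.smoothGrads (z k)) '' (Sum.inr '' A) =
        S.smoothGrads (z k) '' A := fun A => by rw [Set.image_image]; rfl
    obtain ⟨c', h5, h6, h7, h8⟩ := exists_reduced_combination
      (w := Sum.elim (v k) (S.smoothGrads (z k))) (Set.image_mono (f := Sum.inr) hBM)
      (LinearIndepOn.image_of_comp _ _ hk.1) (by rw [himg, himg]; exact hk.2) (c k)
    refine ⟨c', h3.of_sign h7, by rw [h5]; exact h4, fun j hj hjB => h6 _ ⟨j, hj, rfl⟩ ?_, h8,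
      hKk _ h1, fun i => hLk i _ (h2 i)⟩
    simpa using hjB
  -- Pigeonhole: there are finitely many possible supports, so one of them recurs.
  obtain ⟨T, hT⟩ : ∃ T, ∃ᶠ k in atTop, ∃ c' : ι ⊕ κ ⊕ π ⊕ π → ℝ, (S.MultiplierCone x c' ∧
      ξ k + ∑ j, c' j • Sum.elim (v k) (S.smoothGrads (z k)) j + (z k - x) = 0 ∧
      (∀ j ∈ M, j ∉ B → c' (.inr j) = 0) ∧
      LinearIndepOn ℝ (Sum.elim (v k) (S.smoothGrads (z k)))
        (Sum.inr '' B ∪ Function.support c') ∧ ‖ξ k‖ ≤ K ∧ ∀ i, ‖v k i‖ ≤ L i) ∧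
      Function.support c' = T := by
    by_contra hcon
    simp only [not_exists, not_frequently] at hcon
    obtain ⟨k, ⟨c', hc'⟩, hk⟩ := (hred.and (eventually_all.2 hcon)).exists
    exact hk _ c' ⟨hc', rfl⟩
  obtain ⟨θ, hθ, hθT⟩ := extraction_of_frequently_atTop hT
  choose c' hc' hsupp using hθT
  have hpos : ∀ k, 0 < 1 + ‖c' k‖ := fun k => by positivity
  -- Scaling the weight 1 of the objective along with the multipliers keeps everything bounded, with
  -- τ + ‖τ c'‖ = 1, so the limit pair cannot be zero.
  let τ : ℕ → ℝ := fun k => (1 + ‖c' k‖)⁻¹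
  have hτ0 : ∀ k, 0 ≤ τ k := fun k => (inv_pos.2 (hpos k)).le
  have hτ1 : ∀ k, τ k + ‖τ k • c' k‖ = 1 := by
    intro k
    rw [norm_smul, Real.norm_eq_abs, abs_of_nonneg (hτ0 k)]
    have := (hpos k).ne'
    simp only [τ]
    field_simp
  have : ProperSpace E := FiniteDimensional.proper ℝ E
  obtain ⟨⟨ξ₀, v₀, τ₀, c₀⟩, -, η, hη, hlim⟩ :=
    ((isCompact_closedBall (0 : E) K).prod
      ((isCompact_univ_pi fun i => isCompact_closedBall (0 : E) (L i)).prod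
      ((isCompact_closedBall (0 : ℝ) 1).prod
        (isCompact_closedBall (0 : ι ⊕ κ ⊕ π ⊕ π → ℝ) 1)))).tendsto_subseq
      (x := fun k => (ξ (θ k), v (θ k), τ k, τ k • c' k)) (fun k => by
        refine ⟨?_, fun i _ => ?_, ?_, ?_⟩ <;> simp only [mem_closedBall_zero_iff]
        · exact (hc' k).2.2.2.2.1
        · exact (hc' k).2.2.2.2.2 i
        · rw [Real.norm_eq_abs, abs_of_nonneg (hτ0 k)]
          linarith [hτ1 k, norm_nonneg (τ k • c' k)]
        · linarith [hτ1 k, hτ0 k])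
  rw [nhds_prod_eq, nhds_prod_eq, nhds_prod_eq] at hlim
  have hξlim : Tendsto (fun k => ξ (θ (η k))) atTop (𝓝 ξ₀) := hlim.fst
  have hvlim : ∀ i, Tendsto (fun k => v (θ (η k)) i) atTop (𝓝 (v₀ i)) :=
    tendsto_pi_nhds.1 hlim.snd.fst
  have hτlim : Tendsto (fun k => τ (η k)) atTop (𝓝 τ₀) := hlim.snd.snd.fst
  have hclim : Tendsto (fun k => τ (η k) • c' (η k)) atTop (𝓝 c₀) := hlim.snd.snd.snd
  have hzlim : Tendsto (fun k => z (θ (η k))) atTop (𝓝 x) :=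
    hz.comp (hθ.tendsto_atTop.comp hη.tendsto_atTop)
  have hξ₀ : ξ₀ ∈ limitingSubdiff φ x :=
    mem_limitingSubdiff_of_tendsto hφ.continuousAt (fun k => (happ _).1) hzlim hξlim
  have hv₀ : ∀ i, v₀ i ∈ limitingSubdiff (S.g i) x := fun i =>
    mem_limitingSubdiff_of_tendsto (hg i).continuousAt (fun k => (happ _).2.1 i) hzlim (hvlim i)
  have hτ₀ : 0 ≤ τ₀ := ge_of_tendsto' hτlim fun k => hτ0 _
  have hsum1 : τ₀ + ‖c₀‖ = 1 :=
    tendsto_nhds_unique (hτlim.add hclim.norm) (tendsto_const_nhds.congr fun k => (hτ1 _).symm)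
  have hcone : S.MultiplierCone x c₀ := (S.isClosed_multiplierCone x).mem_of_tendsto hclim
    (Eventually.of_forall fun k => (hc' _).1.smul (hτ0 _))
  have hcj : ∀ j, Tendsto (fun k => (τ (η k) • c' (η k)) j) atTop (𝓝 (c₀ j)) :=
    tendsto_pi_nhds.1 hclim
  have hzero : ∀ j, (∀ k, c' k j = 0) → c₀ j = 0 := fun j hj =>
    tendsto_nhds_unique (hcj j) (by simp [hj])
  have heq : τ₀ • ξ₀ + ∑ j, c₀ j • Sum.elim v₀ (S.smoothGrads x) j = 0 := by
    have hw : ∀ j, Tendsto (fun k => Sum.elim (v (θ (η k))) (S.smoothGrads (z (θ (η k)))) j) atTop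
        (𝓝 (Sum.elim v₀ (S.smoothGrads x) j)) := by
      rintro (i | j)
      · exact hvlim i
      · exact ((continuous_smoothGrads hh hG hH j).tendsto x).comp hzlim
    have h1 := ((hτlim.smul hξlim).add (tendsto_finsetSum Finset.univ fun j _ =>
      (hcj j).smul (hw j))).add (hτlim.smul (hzlim.sub_const x))
    rw [sub_self, smul_zero, add_zero] at h1
    refine tendsto_nhds_unique h1 (tendsto_const_nhds.congr fun k => ?_)
    have h2 := congrArg (τ (η k) • ·) (hc' (η k)).2.1
    simpa [smul_add, Finset.smul_sum, mul_smul] using h2.symm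
  -- If τ₀ = 0 the objective drops out and ‖c₀‖ = 1, which RCPLD excludes. If τ₀ > 0, dividing by it
  -- gives genuine multipliers.
  rcases hτ₀.eq_or_lt with h0 | h0
  · rw [← h0, zero_smul, zero_add] at heq
    have hc₀ := hR.eq_zero_of_linearIndepOn (T := T) hx hBM hB hspan hcone
      (fun j hj => hzero j fun k => by
        rw [← hsupp k] at hj
        simpa using hj)
      (fun j hj hjB => hzero _ fun k => (hc' k).2.2.1 j hj hjB)
      (fun i hi => by
        by_contra hia
        rw [← hsupp 0] at hi
        exact hi ((hc' 0).1.inactive i hia))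
      hv₀ heq (fun k => hzx _) hzlim (fun k i => (happ _).2.1 i) hvlim
      (fun k => by rw [← hsupp (η k)]; exact (hc' (η k)).2.2.2.1)
    simp [hc₀, ← h0] at hsum1
  · refine (hcone.smul (inv_pos.2 h0).le).mStationary hξ₀ hv₀ ?_
    have h2 := congrArg (τ₀⁻¹ • ·) heq
    simpa [smul_add, Finset.smul_sum, mul_smul, inv_smul_smul₀ h0.ne'] using h2

end FeasSystem

/-! ### Specialization to the combined program. -/

section CombinedProgram

variable {d s p q m n : ℕ}

theorem contDiff_xPart : ContDiff ℝ 1 (xPart : CPSpace d s m n → _) :=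
  contDiff_euclidean.2 fun i => by simp only [xPart]; fun_prop

theorem contDiff_yPart : ContDiff ℝ 1 (yPart : CPSpace d s m n → _) :=
  contDiff_euclidean.2 fun i => by simp only [yPart]; fun_prop

theorem contDiff_uPart : ContDiff ℝ 1 (uPart : CPSpace d s m n → _) :=
  contDiff_euclidean.2 fun i => by simp only [uPart]; fun_prop

theorem contDiff_vPart : ContDiff ℝ 1 (vPart : CPSpace d s m n → _) :=
  contDiff_euclidean.2 fun i => by simp only [vPart]; fun_prop

theorem contDiff_comp_parts {W : Type*} [NormedAddCommGroup W] [NormedSpace ℝ W]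
    {φ : EuclideanSpace ℝ (Fin d) → EuclideanSpace ℝ (Fin s) → W}
    (hφ : ContDiff ℝ 1 (Function.uncurry φ)) :
    ContDiff ℝ 1 fun z : CPSpace d s m n => φ (xPart z) (yPart z) :=
  hφ.comp (contDiff_xPart.prodMk contDiff_yPart)

namespace BilevelProgram

variable {P : BilevelProgram d s p q m n}

theorem contDiff_lagrangianGradY (hf' : ContDiff ℝ 1 (Function.uncurry (gradY P.f)))
    (hg' : ∀ i, ContDiff ℝ 1 (Function.uncurry (gradY (P.g i))))
    (hh' : ∀ i, ContDiff ℝ 1 (Function.uncurry (gradY (P.h i)))) :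
    ContDiff ℝ 1 P.lagrangianGradY :=
  ((contDiff_comp_parts hf').add (ContDiff.sum fun i _ =>
    (contDiff_euclidean.1 contDiff_uPart i).smul (contDiff_comp_parts (hg' i)))).add
    (ContDiff.sum fun i _ =>
      (contDiff_euclidean.1 contDiff_vPart i).smul (contDiff_comp_parts (hh' i)))

/-- Where the value function is finite, the constraint system describes the feasible set of the
combined program. -/
theorem isFeasible_cpSystem_iff {z : CPSpace d s m n} (htop : P.V (xPart z) ≠ ⊤)
    (hbot : P.V (xPart z) ≠ ⊥) : P.cpSystem.IsFeasible z ↔ z ∈ P.cpFeasible := by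
  have h1 : P.f (xPart z) (yPart z) - (P.V (xPart z)).toReal ≤ 0 ↔
      (P.f (xPart z) (yPart z) : EReal) ≤ P.V (xPart z) := by
    rw [sub_nonpos, ← EReal.coe_le_coe_iff, EReal.coe_toReal htop hbot]
  have h2 : P.lagrangianGradY z = 0 ↔ ∀ i, P.lagrangianGradY z i = 0 := by
    constructor
    · intro h i; simp [h]
    · intro h; ext i; simpa using h i
  simp only [FeasSystem.IsFeasible, cpSystem, cpFeasible, Sum.forall, Sum.elim_inl, Sum.elim_inr,
    Set.mem_ofPred_eq, forall_const, h1, h2]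
  tauto

end BilevelProgram

end CombinedProgram

end BilevelRCPLD

theorem theorem5p1 {d s p q m n : ℕ} (P : BilevelRCPLD.BilevelProgram d s p q m n)
    (hF : LocallyLipschitz (Function.uncurry P.F))
    (hG : ∀ i, ContDiff ℝ 1 (Function.uncurry (P.G i)))
    (hH : ∀ i, ContDiff ℝ 1 (Function.uncurry (P.H i)))
    (hf : ContDiff ℝ 1 (Function.uncurry P.f))
    (hf' : ContDiff ℝ 1 (Function.uncurry (BilevelRCPLD.gradY P.f)))
    (hg : ∀ i, ContDiff ℝ 1 (Function.uncurry (P.g i)))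
    (hg' : ∀ i, ContDiff ℝ 1 (Function.uncurry (BilevelRCPLD.gradY (P.g i))))
    (hh : ∀ i, ContDiff ℝ 1 (Function.uncurry (P.h i)))
    (hh' : ∀ i, ContDiff ℝ 1 (Function.uncurry (BilevelRCPLD.gradY (P.h i))))
    (z : BilevelRCPLD.CPSpace d s m n)
    (hz : P.IsLocalSolutionCP z)
    (hV : P.VLipschitzAt (BilevelRCPLD.xPart z))
    (hR : P.cpSystem.RCPLD z) :
    P.cpSystem.MStationary P.cpObjective z := by
  open BilevelRCPLD BilevelProgram in
  obtain ⟨U, hU, hfin, L, hL⟩ := hV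
  have hxc : ContinuousAt (xPart : CPSpace d s m n → _) z := contDiff_xPart.continuous.continuousAt
  -- `cpSystem` uses `toReal` of `V`, which is faithful only where `V` is finite, so the two
  -- feasible sets are compared only near `z`.
  have hfeas : ∀ᶠ y in 𝓝 z, (P.cpSystem.IsFeasible y ↔ y ∈ P.cpFeasible) :=
    (hxc.eventually hU).mono fun y hy =>
      isFeasible_cpSystem_iff (hfin _ hy).1 (hfin _ hy).2
  refine hR.mStationary ?_ ?_ ?_ ?_ ?_ (hfeas.self_of_nhds.2 hz.1) ?_
  · exact (hF.lipschitzNear (xPart z, yPart z)).comp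
      (g := fun y : CPSpace d s m n => (xPart y, yPart y))
      (contDiff_xPart.prodMk contDiff_yPart).locallyLipschitz
  · rintro (_ | i)
    · have hVz : LipschitzNear (fun x => (P.V x).toReal) (xPart z) := ⟨L, U, hU, hL⟩
      exact ((contDiff_comp_parts hf).locallyLipschitz.lipschitzNear z).sub
        (hVz.comp contDiff_xPart.locallyLipschitz)
    · exact (contDiff_comp_parts (hG i)).locallyLipschitz.lipschitzNear z
  · rintro (i | i | i)
    exacts [contDiff_comp_parts (hH i), contDiff_comp_parts (hh i),
      contDiff_euclidean.1 (contDiff_lagrangianGradY hf' hg' hh') i]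
  · exact fun i => (contDiff_comp_parts (hg i)).neg
  · exact fun i => contDiff_euclidean.1 contDiff_uPart i
  · filter_upwards [hfeas, eventually_nhdsWithin_iff.1 hz.2] with y hy hmin hyf
    exact hmin (hy.1 hyf)
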